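/- **Setting.** Let $\mathbb T_1,\mathbb T_2,\mathbb T_3$ be time scales (nonempty closed subsets of $\mathbb R$) with forward jump operators $\sigma_i$ and graininess $\mu_i(t)=\sigma_i(t)-t$. Let $\mathbb T_1,\mathbb T_2$ have at least two points, $x_0=\min\mathbb T_1$, $y_0=\min\mathbb T_2$. Let $a<b$ be points of $\mathbb T_3$ and $I=[a,b]\cap\mathbb T_3$ (for $\mathbb T_3=\mathbb R$ this is the real interval $[a,b]$ and $\Delta q=dq$). Put $\Omega=\mathbb T_1\times\mathbb T_2$, $\overline\Omega=\Omega\times I$. Let $\mathbb T^\kappa$ be $\mathbb T$ without its maximum if it has a left-scattered one, and $\mathbb T^\kappa=\mathbb T$ otherwise. Delta derivatives are taken at points of $\mathbb T^\kappa$; at a left-scattered maximum, where $f^\Delta$ is not defined, $f^\Delta$ is read as $0$ wherever it occurs below. $\Delta$-integrals are Lebesgue delta integrals. A function of one time scale variable is rd-continuous if it is continuous at each point $t$ with $\sigma(t)=t$ and has a finite left limit at each left-dense point. A function of several time scale variables and real variables is rd-continuous ($C_{rd}$) if, at each point, for every subset $A$ of the time scale variables, it has a finite joint limit when each variable in $A$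 tends to its value strictly from the left, each other time scale variable at a $t$ with $\sigma(t)=t$ tends to $t$ in its time scale, each other time scale variable is kept fixed, and the real variables tend to their values; for $A=\emptyset$ this limit is required to be the value of the function. (If all time scales are $\mathbb R$ this is joint continuity.) Let $\lambda>0$, assume $0\in\mathbb T_3$ and $|z|\in\mathbb T_3$ for $z\in I$, and let $$e_\lambda(x,y,|z|)=e^{\mathbb T_1}_\lambda(x,x_0)\,e^{\mathbb T_2}_\lambda(y,y_0)\,e^{\mathbb T_3}_\lambda(|z|,0),\qquad e^{\mathbb T}_\lambda(t,s)=\exp\Big(\int_s^t\xi_{\mu(\tau)}(\lambda)\,\Delta\tau\Big),$$ where $\xi_h(\lambda)=\frac{\log(1+h\lambda)}{h}$ for $h>0$ and $\xi_0(\lambda)=\lambda$. For real time scales the weight is $e^{\lambda((x-x_0)+(y-y_0)+|z|)}$. Let $F\in C_{rd}(\overline\Omega\times\mathbb R^4,\mathbb R)$, $G\in C_{rd}(\overline\Omega\times I\times\mathbb R^3,\mathbb R)$, and let $\alpha\in C_{rd}(\mathbb T_1\times I,\mathbb R)$, $\beta\in C_{rd}(\mathbb T_2\times I,\mathbb R)$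 have rd-continuous delta derivatives $\alpha^{\Delta}$, $\beta^{\Delta}$ with respect to their first variables, with $\alpha(x_0,z)=\beta(y_0,z)$ for $z\in I$. Consider the problem $$u^{\Delta_2\Delta_1}(x,y,z)=F\big(x,y,z,u,u^{\Delta_1},u^{\Delta_2},(Hu)(x,y,z)\big),\qquad (x,y,z)\in\mathbb T_1^\kappa\times\mathbb T_2^\kappa\times I,\tag{1.1}$$ $$u(x,y_0,z)=\alpha(x,z),\qquad u(x_0,y,z)=\beta(y,z),\tag{1.2}$$ $$(Hu)(x,y,z)=\int_a^bG\big(x,y,z,q,u(x,y,q),u^{\Delta_1}(x,y,q),u^{\Delta_2}(x,y,q)\big)\,\Delta q,\tag{1.3}$$ where $u,u^{\Delta_1},u^{\Delta_2}$ in $F$ are taken at $(x,y,z)$ and $u^{\Delta_2\Delta_1}=(u^{\Delta_2})^{\Delta_1}$. Let $S$ be the set of all $u:\overline\Omega\to\mathbb R$ that are delta differentiable in $x$ and in $y$, with $u,u^{\Delta_1},u^{\Delta_2}\in C_{rd}(\overline\Omega,\mathbb R)$, such that for some $N\ge0$ $$|u(x,y,z)|+|u^{\Delta_1}(x,y,z)|+|u^{\Delta_2}(x,y,z)|\le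 N\,e_\lambda(x,y,|z|)\quad\text{on }\overline\Omega .$$ **Theorem 1.1.** Suppose there are nonnegative $M\in C_{rd}(\overline\Omega,\mathbb R)$ and $K\in C_{rd}(\overline\Omega\times I,\mathbb R)$ with $$|F(x,y,z,u_1,\dots,u_4)-F(x,y,z,\bar u_1,\dots,\bar u_4)|\le M(x,y,z)\sum_{i=1}^4|u_i-\bar u_i|,\tag{2.1}$$ $$|G(x,y,z,q,u_1,u_2,u_3)-G(x,y,z,q,\bar u_1,\bar u_2,\bar u_3)|\le K(x,y,z,q)\sum_{i=1}^3|u_i-\bar u_i|\tag{2.2}$$ for all arguments, and nonnegative constants $\gamma_1,\gamma_2,\gamma_3,\eta_1,\eta_2,\eta_3$ such that, with $$E(s,t,z)=M(s,t,z)\Big[e_\lambda(s,t,|z|)+\int_a^bK(s,t,z,q)\,e_\lambda(s,t,|q|)\,\Delta q\Big],\qquad F_0(s,t,z)=F\big(s,t,z,0,0,0,(H0)(s,t,z)\big),$$ one has for all $(x,y,z)\in\overline\Omega$ (in (2.7) only for $x\in\mathbb T_1^\kappa$, in (2.8) only for $y\in\mathbb T_2^\kappa$) $$\int_{x_0}^x\!\int_{y_0}^yE(s,t,z)\,\Delta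 t\,\Delta s\le\gamma_1e_\lambda(x,y,|z|),\tag{2.3}$$ $$\int_{y_0}^yE(x,t,z)\,\Delta t\le\gamma_2e_\lambda(x,y,|z|),\tag{2.4}$$ $$\int_{x_0}^xE(s,y,z)\,\Delta s\le\gamma_3e_\lambda(x,y,|z|),\tag{2.5}$$ $$|\alpha(x,z)|+|\beta(y,z)|+|\alpha(x_0,z)|+\int_{x_0}^x\!\int_{y_0}^y|F_0(s,t,z)|\,\Delta t\,\Delta s\le\eta_1e_\lambda(x,y,|z|),\tag{2.6}$$ $$|\alpha^{\Delta}(x,z)|+\int_{y_0}^y|F_0(x,t,z)|\,\Delta t\le\eta_2e_\lambda(x,y,|z|),\tag{2.7}$$ $$|\beta^{\Delta}(y,z)|+\int_{x_0}^x|F_0(s,y,z)|\,\Delta s\le\eta_3e_\lambda(x,y,|z|).\tag{2.8}$$ If $\gamma_1+\gamma_2+\gamma_3<1$, then problem (1.1)–(1.2) has exactly one solution $u$ in $S$. -/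

import Mathlib

open Set Filter Topology

noncomputable section

namespace TimeScale

/-- A time scale: a nonempty closed subset of `ℝ`. -/
def IsTimeScale (T : Set ℝ) : Prop := T.Nonempty ∧ IsClosed T

open Classical in
/-- Forward jump operator `σ(t) = inf {s ∈ T : s > t}`, and `σ(t) = t` if there is no such `s`. -/
def sigma (T : Set ℝ) (t : ℝ) : ℝ :=
  if (T ∩ Ioi t).Nonempty then sInf (T ∩ Ioi t) else t

open Classical in
/-- Backward jump operator `ρ(t) = sup {s ∈ T : s < t}`, and `ρ(t) = t` if there is no such `s`. -/
def rho (T : Set ℝ) (t : ℝ) : ℝ :=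
  if (T ∩ Iio t).Nonempty then sSup (T ∩ Iio t) else t

/-- Graininess `μ(t) = σ(t) - t`. -/
def graininess (T : Set ℝ) (t : ℝ) : ℝ := sigma T t - t

/-- `T^κ`: the time scale `T` without its maximum, if it has a left-scattered one; otherwise `T`. -/
def kappa (T : Set ℝ) : Set ℝ := {t ∈ T | ¬ (IsGreatest T t ∧ rho T t < t)}

/-- `L` is a delta derivative of `f` at `t`. -/
def HasDeltaDerivAt (T : Set ℝ) (f : ℝ → ℝ) (L t : ℝ) : Prop :=
  ∀ ε > 0, ∃ δ > 0, ∀ s ∈ T, |s - t| < δ →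
    |f (sigma T t) - f s - L * (sigma T t - s)| ≤ ε * |sigma T t - s|

/-- `f` is delta differentiable on `T`, that is, at every point of `T^κ`. -/
def DeltaDifferentiable (T : Set ℝ) (f : ℝ → ℝ) : Prop :=
  ∀ t ∈ kappa T, ∃ L, HasDeltaDerivAt T f L t

open Classical in
/-- The delta derivative `f^Δ(t)`. At a left-scattered maximum of `T` (a point outside `T^κ`), where
delta derivatives are not defined, it is taken to be `0`; that is, a term with a derivative is
absent there. -/
def deltaDeriv (T : Set ℝ) (f : ℝ → ℝ) (t : ℝ) : ℝ :=
  if h : t ∈ kappa T ∧ ∃ L, HasDeltaDerivAt T f L t then Classical.choose h.2 else 0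

/-- The delta integral `∫_s^t f(τ) Δτ` for `s, t ∈ T` (Lebesgue delta integral): `f` is extended
from `T` to the gaps `(τ, σ(τ))` of `T` by its value at `τ`, then integrated over `[s, t]`. Here
`sSup (T ∩ Iic r)` is the last point of `T` that is not after `r`. -/
def deltaIntegral (T : Set ℝ) (f : ℝ → ℝ) (s t : ℝ) : ℝ :=
  ∫ r in s..t, f (sSup (T ∩ Iic r))

open Classical in
/-- Cylinder transformation `ξ_h(w) = log (1 + h w) / h`, and `ξ_0(w) = w`. -/
def cylinder (h w : ℝ) : ℝ := if h = 0 then w else Real.log (1 + h * w) / h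

/-- The exponential function `e_p(t, s) = exp (∫_s^t ξ_{μ(τ)}(p(τ)) Δτ)` of the time scale `T`, for a
positively regressive `p`. -/
def tsExp (T : Set ℝ) (p : ℝ → ℝ) (t s : ℝ) : ℝ :=
  Real.exp (deltaIntegral T (fun τ => cylinder (graininess T τ) (p τ)) s t)

/-- The weight `e_lam(x, y, |z|) = e_lam(x, x₀) e_lam(y, y₀) e_lam(|z|, 0)`, each factor formed in
the time scale of its variable. If all three time scales are real it is
`exp (lam ((x - x₀) + (y - y₀) + |z|))`. -/
def expWeight (T₁ T₂ T₃ : Set ℝ) (x₀ y₀ lam x y z : ℝ) : ℝ :=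
  tsExp T₁ (fun _ => lam) x x₀ * tsExp T₂ (fun _ => lam) y y₀ * tsExp T₃ (fun _ => lam) |z| 0

open Classical in
/-- The approach to `t` under which an rd-continuous function tends to its value at `t`: through
all points of `T` if `t` is right-dense (`σ(t) = t`), and only `t` itself otherwise. -/
def valueApproach (T : Set ℝ) (t : ℝ) : Filter ℝ :=
  if sigma T t = t then 𝓝[T] t else pure t

/-- The approach to `t` through the points of `T` before `t` (trivial if `t` is left-scattered). -/
def leftApproach (T : Set ℝ) (t : ℝ) : Filter ℝ := 𝓝[T ∩ Iio t] t

/-- (Joint) rd-continuity on `T₁ × ⋯ × Tₙ × ℝᵐ` of a function of `n` time scale variables and `m`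
real variables, in which it is continuous. A one-variable `f` (`n = 1`, `m = 0`) is rd-continuous if
it is continuous at right-dense points and has finite left limits at left-dense points. For several
variables, some of them (those in `A`) may be taken to their left limit; the joint limit has to
exist and to be finite for every choice of `A`, and for empty `A` it has to be the value of `f`. -/
def RdContinuous {n m : ℕ} (T : Fin n → Set ℝ) (f : (Fin n → ℝ) → (Fin m → ℝ) → ℝ) : Prop :=
  ∀ t : Fin n → ℝ, (∀ i, t i ∈ T i) → ∀ p : Fin m → ℝ,
    Tendsto (fun w : (Fin n → ℝ) × (Fin m → ℝ) => f w.1 w.2)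
      (Filter.pi (fun i => valueApproach (T i) (t i)) ×ˢ 𝓝 p) (𝓝 (f t p)) ∧
    ∀ A : Finset (Fin n), ∃ L : ℝ,
      Tendsto (fun w : (Fin n → ℝ) × (Fin m → ℝ) => f w.1 w.2)
        (Filter.pi (fun i => if i ∈ A then leftApproach (T i) (t i)
          else valueApproach (T i) (t i)) ×ˢ 𝓝 p) (𝓝 L)

/-- `h ∈ C_rd(T × T')`. -/
def RdContinuous₂ (T T' : Set ℝ) (h : ℝ → ℝ → ℝ) : Prop :=
  RdContinuous (m := 0) ![T, T'] (fun t _ => h (t 0) (t 1))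

/-- `h ∈ C_rd(T × T' × T'')`. -/
def RdContinuous₃ (T T' T'' : Set ℝ) (h : ℝ → ℝ → ℝ → ℝ) : Prop :=
  RdContinuous (m := 0) ![T, T', T''] (fun t _ => h (t 0) (t 1) (t 2))

/-- Partial delta derivative `u^{Δ₁}` with respect to the first variable. -/
def pderiv₁ (T₁ : Set ℝ) (u : ℝ → ℝ → ℝ → ℝ) (x y z : ℝ) : ℝ :=
  deltaDeriv T₁ (fun s => u s y z) x

/-- Partial delta derivative `u^{Δ₂}` with respect to the second variable. -/
def pderiv₂ (T₂ : Set ℝ) (u : ℝ → ℝ → ℝ → ℝ) (x y z : ℝ) : ℝ :=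
  deltaDeriv T₂ (fun t => u x t z) y

/-- `|u(x, y, z)|_W = |u| + |u^{Δ₁}| + |u^{Δ₂}|`. -/
def absW (T₁ T₂ : Set ℝ) (u : ℝ → ℝ → ℝ → ℝ) (x y z : ℝ) : ℝ :=
  |u x y z| + |pderiv₁ T₁ u x y z| + |pderiv₂ T₂ u x y z|

/-- The integral operator
`(Hu)(x, y, z) = ∫_a^b G(x, y, z, q, u(x, y, q), u^{Δ₁}(x, y, q), u^{Δ₂}(x, y, q)) Δq`. -/
def opH (T₁ T₂ T₃ : Set ℝ) (a b : ℝ) (G : ℝ → ℝ → ℝ → ℝ → ℝ → ℝ → ℝ → ℝ)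
    (u : ℝ → ℝ → ℝ → ℝ) (x y z : ℝ) : ℝ :=
  deltaIntegral T₃
    (fun q => G x y z q (u x y q) (pderiv₁ T₁ u x y q) (pderiv₂ T₂ u x y q)) a b

/-- The space `S` of functions on `T₁ × T₂ × I`, `I = T₃ ∩ [a, b]`, that are rd-continuous with
rd-continuous partial delta derivatives and satisfy `|u|_W = O(e_lam(x, y, |z|))`. -/
structure MemS (T₁ T₂ T₃ : Set ℝ) (a b x₀ y₀ lam : ℝ) (u : ℝ → ℝ → ℝ → ℝ) : Prop where
  diff₁ : ∀ y ∈ T₂, ∀ z ∈ T₃ ∩ Icc a b, DeltaDifferentiable T₁ (fun s => u s y z)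
  diff₂ : ∀ x ∈ T₁, ∀ z ∈ T₃ ∩ Icc a b, DeltaDifferentiable T₂ (fun t => u x t z)
  rd : RdContinuous₃ T₁ T₂ (T₃ ∩ Icc a b) u
  rd₁ : RdContinuous₃ T₁ T₂ (T₃ ∩ Icc a b) (pderiv₁ T₁ u)
  rd₂ : RdContinuous₃ T₁ T₂ (T₃ ∩ Icc a b) (pderiv₂ T₂ u)
  growth : ∃ N : ℝ, 0 ≤ N ∧ ∀ x ∈ T₁, ∀ y ∈ T₂, ∀ z ∈ T₃ ∩ Icc a b,
    absW T₁ T₂ u x y z ≤ N * expWeight T₁ T₂ T₃ x₀ y₀ lam x y z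

/-- `u` solves `u^{Δ₂Δ₁} = F(x, y, z, u, u^{Δ₁}, u^{Δ₂}, Hu)` with `u(x, y₀, z) = α(x, z)` and
`u(x₀, y, z) = β(y, z)`. As usual the equation is required where the derivatives make sense, that
is, on `T₁^κ × T₂^κ × I`. -/
structure IsSolution (T₁ T₂ T₃ : Set ℝ) (a b x₀ y₀ : ℝ)
    (F : ℝ → ℝ → ℝ → ℝ → ℝ → ℝ → ℝ → ℝ) (G : ℝ → ℝ → ℝ → ℝ → ℝ → ℝ → ℝ → ℝ)
    (α β : ℝ → ℝ → ℝ) (u : ℝ → ℝ → ℝ → ℝ) : Prop where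
  eqn : ∀ x ∈ kappa T₁, ∀ y ∈ kappa T₂, ∀ z ∈ T₃ ∩ Icc a b,
    HasDeltaDerivAt T₁ (fun s => pderiv₂ T₂ u s y z)
      (F x y z (u x y z) (pderiv₁ T₁ u x y z) (pderiv₂ T₂ u x y z)
        (opH T₁ T₂ T₃ a b G u x y z)) x
  bdry₁ : ∀ x ∈ T₁, ∀ z ∈ T₃ ∩ Icc a b, u x y₀ z = α x z
  bdry₂ : ∀ y ∈ T₂, ∀ z ∈ T₃ ∩ Icc a b, u x₀ y z = β y z

end TimeScale

end

/-!
The problem is rewritten as a fixed point equation for the jet `w = (u, u^{Δ₁}, u^{Δ₂})`. For a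
given right-hand side `f` the Goursat problem `u^{Δ₂Δ₁} = f`, with boundary values `α` and `β`, is
solved by `α + β - α(x₀, ·) + ∫∫ f`, whose derivatives are `α^Δ + ∫ f Δt` and `β^Δ + ∫ f Δs`
(`goursat`); conversely every solution is of this form (`GoursatData.eq_goursat`). Hence the
solutions are the fixed points of the map `A` that sends `w` to `goursat` of the right-hand side
formed with `w`. By the Lipschitz conditions and the three integral bounds, `A` contracts the
distance `sup (|u - u'| + |p - p'| + |q - q'|) / e_λ` of jets `(u, p, q)` and `(u', p', q')` by the
factor `γ₁ + γ₂ + γ₃`, and the growth bounds for the data say that the zero jet has finite distance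
from its image. The rd-continuous jets are closed under limits in this distance, since `e_λ` is
locally bounded (`RdCont.of_weighted_limit`), and Banach's argument applies.

What has to be supplied is calculus for rd-continuous functions of several variables. The
approaches to a point that occur in the definition of rd-continuity form a family of filters, and
the notion is treated for arbitrary such families (`RdDomain`, `RdCont`), which makes products,
substitutions and slices formal. Its analytic content is in the following facts.

* The two approaches to a point of a time scale cover a neighbourhood of it, so that rd-continuous
  functions are bounded on compact sets, locally uniformly in parameters
  (`RdCont.eventually_bound`). By dominated convergence, integrals are rd-continuous in their
  parameters and limits (`RdCont.deltaIntegral`).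
* The map `lastPoint`, which extends functions from a time scale to `ℝ`, is right-continuous into
  the approach along which rd-continuous functions tend to their values. So the extensions are
  jointly right-continuous, hence measurable, and Fubini's theorem holds (`deltaIntegral_swap`).
* The fundamental theorem of calculus: `hasDeltaDerivAt_deltaIntegral` and, since functions with
  delta derivative zero are constant (`eq_of_hasDeltaDerivAt_zero`), `eq_add_deltaIntegral`.
-/

namespace TimeScale

open MeasureTheory

/-! ### Forward jumps -/

lemma le_sigma (T : Set ℝ) (t : ℝ) : t ≤ sigma T t := by
  unfold sigma
  split_ifs with h
  · exact le_csInf h fun s hs => le_of_lt hs.2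
  · exact le_rfl

lemma sigma_le {T : Set ℝ} {s t : ℝ} (hs : s ∈ T) (hts : t < s) : sigma T t ≤ s := by
  have hne : (T ∩ Ioi t).Nonempty := ⟨s, hs, hts⟩
  rw [sigma, if_pos hne]
  exact csInf_le ⟨t, fun r hr => le_of_lt hr.2⟩ ⟨hs, hts⟩

lemma sigma_mem {T : Set ℝ} (hT : IsClosed T) {t : ℝ} (ht : t ∈ T) : sigma T t ∈ T := by
  unfold sigma
  split_ifs with h
  · exact closure_minimal inter_subset_left hT
      (csInf_mem_closure h ⟨t, fun r hr => le_of_lt hr.2⟩)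
  · exact ht

lemma sigma_mono (T : Set ℝ) : Monotone (sigma T) := by
  intro t t' htt'
  by_cases h' : (T ∩ Ioi t').Nonempty
  · rw [sigma, sigma, if_pos h',
      if_pos (h'.mono (inter_subset_inter_right T (Ioi_subset_Ioi htt')))]
    exact csInf_le_csInf ⟨t, fun r hr => le_of_lt hr.2⟩ h'
      fun r hr => ⟨hr.1, lt_of_le_of_lt htt' hr.2⟩
  · by_cases h : (T ∩ Ioi t).Nonempty
    · obtain ⟨s, hs, hts⟩ := h
      refine (sigma_le hs hts).trans ((not_lt.1 fun hst => h' ⟨s, hs, hst⟩).trans (le_sigma T t'))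
    · rw [sigma, sigma, if_neg h, if_neg h']
      exact htt'

lemma exists_gt_of_rightDense {T : Set ℝ} {t : ℝ} (h : sigma T t = t) (hne : (T ∩ Ioi t).Nonempty)
    {ε : ℝ} (hε : 0 < ε) : ∃ s ∈ T, t < s ∧ s < t + ε := by
  rw [sigma, if_pos hne] at h
  obtain ⟨s, hs, hlt⟩ := exists_lt_of_csInf_lt hne (show sInf (T ∩ Ioi t) < t + ε by linarith)
  exact ⟨s, hs.1, hs.2, hlt⟩

lemma mem_kappa_of_lt {T : Set ℝ} {s t : ℝ} (ht : t ∈ T) (hs : s ∈ T) (hts : t < s) :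
    t ∈ kappa T :=
  ⟨ht, fun h => absurd (h.1.2 hs) (not_le.2 hts)⟩

/-- A point of `T` outside `T^κ` is isolated in `T`. -/
lemma exists_isolated_of_notMem_kappa {T : Set ℝ} {t : ℝ} (ht : t ∈ T) (hk : t ∉ kappa T) :
    ∃ δ > 0, ∀ s ∈ T, |s - t| < δ → s = t := by
  have h : IsGreatest T t ∧ rho T t < t := by
    by_contra h
    exact hk ⟨ht, h⟩
  refine ⟨t - rho T t, sub_pos.2 h.2, fun s hs hst => ?_⟩
  by_contra hne
  have hlt : s < t := lt_of_le_of_ne (h.1.2 hs) hne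
  have hle : s ≤ rho T t := by
    rw [rho, if_pos ⟨s, hs, hlt⟩]
    exact le_csSup ⟨t, fun r hr => le_of_lt hr.2⟩ ⟨hs, hlt⟩
  rw [abs_lt] at hst
  linarith

/-- In a time scale with at least two points, a right-dense point of `T^κ` is an accumulation
point. -/
lemma exists_ne_of_mem_kappa {T : Set ℝ} (hT : T.Nontrivial) {t : ℝ} (hk : t ∈ kappa T)
    (h : sigma T t = t) {δ : ℝ} (hδ : 0 < δ) : ∃ s ∈ T, |s - t| < δ ∧ s ≠ t := by
  by_cases hne : (T ∩ Ioi t).Nonempty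
  · obtain ⟨s, hs, hts, hsd⟩ := exists_gt_of_rightDense h hne hδ
    exact ⟨s, hs, by rw [abs_lt]; constructor <;> linarith, hts.ne'⟩
  · have hmax : IsGreatest T t := ⟨hk.1, fun s hs => not_lt.1 fun hts => hne ⟨s, hs, hts⟩⟩
    have hrho : t ≤ rho T t := not_lt.1 fun hlt => hk.2 ⟨hmax, hlt⟩
    obtain ⟨s, hs, hst⟩ := hT.exists_ne t
    have hlt : s < t := lt_of_le_of_ne (hmax.2 hs) hst
    have hne' : (T ∩ Iio t).Nonempty := ⟨s, hs, hlt⟩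
    rw [rho, if_pos hne'] at hrho
    obtain ⟨r, hr, hlt'⟩ := exists_lt_of_lt_csSup hne' (show t - δ < _ by linarith)
    have hrt : r < t := hr.2
    exact ⟨r, hr.1, by rw [abs_lt]; constructor <;> linarith, hrt.ne⟩

/-! ### Delta derivatives -/

lemma HasDeltaDerivAt.unique {T : Set ℝ} (hT : T.Nontrivial) {f : ℝ → ℝ} {L L' t : ℝ}
    (hk : t ∈ kappa T) (h : HasDeltaDerivAt T f L t) (h' : HasDeltaDerivAt T f L' t) : L = L' := by
  have key : ∀ ε > 0, |L - L'| ≤ 2 * ε := by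
    intro ε hε
    obtain ⟨δ, hδ, hd⟩ := h ε hε
    obtain ⟨δ', hδ', hd'⟩ := h' ε hε
    obtain ⟨s, hs, hsδ, hsne⟩ : ∃ s ∈ T, |s - t| < min δ δ' ∧ s ≠ sigma T t := by
      by_cases hσ : sigma T t = t
      · rw [hσ]
        exact exists_ne_of_mem_kappa hT hk hσ (lt_min hδ hδ')
      · exact ⟨t, hk.1, by simp [hδ, hδ'], fun h => hσ h.symm⟩
    have h1 := hd s hs (hsδ.trans_le (min_le_left _ _))
    have h2 := hd' s hs (hsδ.trans_le (min_le_right _ _))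
    have hpos : 0 < |sigma T t - s| := abs_pos.2 (sub_ne_zero.2 hsne.symm)
    have h3 : |L - L'| * |sigma T t - s| ≤ 2 * ε * |sigma T t - s| := by
      rw [← abs_mul]
      have : (L - L') * (sigma T t - s) = (f (sigma T t) - f s - L' * (sigma T t - s)) -
        (f (sigma T t) - f s - L * (sigma T t - s)) := by ring
      rw [this]
      refine (abs_sub _ _).trans ?_
      linarith
    exact le_of_mul_le_mul_right h3 hpos
  have h0 : |L - L'| ≤ 0 := le_of_forall_pos_le_add fun ε hε => by
    have := key (ε / 2) (half_pos hε)
    linarith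
  exact sub_eq_zero.1 (abs_nonpos_iff.1 h0)

lemma HasDeltaDerivAt.deltaDeriv_eq {T : Set ℝ} (hT : T.Nontrivial) {f : ℝ → ℝ} {L t : ℝ}
    (hk : t ∈ kappa T) (h : HasDeltaDerivAt T f L t) : deltaDeriv T f t = L := by
  have hex : t ∈ kappa T ∧ ∃ L, HasDeltaDerivAt T f L t := ⟨hk, L, h⟩
  rw [deltaDeriv, dif_pos hex]
  exact (Classical.choose_spec hex.2).unique hT hk h

lemma DeltaDifferentiable.hasDeltaDerivAt {T : Set ℝ} {f : ℝ → ℝ} (h : DeltaDifferentiable T f)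
    {t : ℝ} (hk : t ∈ kappa T) : HasDeltaDerivAt T f (deltaDeriv T f t) t := by
  have hex : t ∈ kappa T ∧ ∃ L, HasDeltaDerivAt T f L t := ⟨hk, h t hk⟩
  rw [deltaDeriv, dif_pos hex]
  exact Classical.choose_spec hex.2

lemma deltaDeriv_of_notMem {T : Set ℝ} {f : ℝ → ℝ} {t : ℝ} (hk : t ∉ kappa T) :
    deltaDeriv T f t = 0 := by
  rw [deltaDeriv, dif_neg fun h => hk h.1]

lemma HasDeltaDerivAt.congr {T : Set ℝ} (hT : IsClosed T) {f g : ℝ → ℝ} {L t : ℝ} (ht : t ∈ T)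
    (h : HasDeltaDerivAt T f L t) (hfg : ∀ s ∈ T, g s = f s) : HasDeltaDerivAt T g L t := by
  intro ε hε
  obtain ⟨δ, hδ, hd⟩ := h ε hε
  refine ⟨δ, hδ, fun s hs hsδ => ?_⟩
  rw [hfg s hs, hfg _ (sigma_mem hT ht)]
  exact hd s hs hsδ

lemma HasDeltaDerivAt.add {T : Set ℝ} {f g : ℝ → ℝ} {L L' t : ℝ} (hf : HasDeltaDerivAt T f L t)
    (hg : HasDeltaDerivAt T g L' t) : HasDeltaDerivAt T (fun s => f s + g s) (L + L') t := by
  intro ε hε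
  obtain ⟨δ, hδ, hd⟩ := hf (ε / 2) (half_pos hε)
  obtain ⟨δ', hδ', hd'⟩ := hg (ε / 2) (half_pos hε)
  refine ⟨min δ δ', lt_min hδ hδ', fun s hs hsδ => ?_⟩
  have h1 := hd s hs (hsδ.trans_le (min_le_left _ _))
  have h2 := hd' s hs (hsδ.trans_le (min_le_right _ _))
  calc _ = |(f (sigma T t) - f s - L * (sigma T t - s)) +
        (g (sigma T t) - g s - L' * (sigma T t - s))| := by congr 1; ring
    _ ≤ _ := (abs_add_le _ _).trans (by linarith)

lemma HasDeltaDerivAt.neg {T : Set ℝ} {f : ℝ → ℝ} {L t : ℝ} (hf : HasDeltaDerivAt T f L t) :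
    HasDeltaDerivAt T (fun s => -f s) (-L) t := by
  intro ε hε
  obtain ⟨δ, hδ, hd⟩ := hf ε hε
  refine ⟨δ, hδ, fun s hs hsδ => ?_⟩
  rw [← abs_neg]
  convert hd s hs hsδ using 2
  ring

lemma hasDeltaDerivAt_const (T : Set ℝ) (c t : ℝ) : HasDeltaDerivAt T (fun _ => c) 0 t :=
  fun ε hε => ⟨1, one_pos, fun s _ _ => by
    simpa using mul_nonneg hε.le (abs_nonneg (sigma T t - s))⟩

lemma deltaDeriv_zero {T : Set ℝ} (hT : T.Nontrivial) (t : ℝ) :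
    deltaDeriv T (fun _ => 0) t = 0 := by
  by_cases hk : t ∈ kappa T
  · exact (hasDeltaDerivAt_const T 0 t).deltaDeriv_eq hT hk
  · exact deltaDeriv_of_notMem hk

lemma HasDeltaDerivAt.continuousWithinAt {T : Set ℝ} {f : ℝ → ℝ} {L t : ℝ} (ht : t ∈ T)
    (hf : HasDeltaDerivAt T f L t) : ContinuousWithinAt f T t := by
  -- For `s` near `t`, comparing the estimates at `s` and at `t` bounds `f s - f t - L (s - t)`
  -- by `ε (2 (σ t - t) + |s - t|)`.
  rw [Metric.continuousWithinAt_iff]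
  intro ε hε
  set m := sigma T t - t with hm
  have hm0 : 0 ≤ m := sub_nonneg.2 (le_sigma T t)
  set η := ε / (4 * (m + 1)) with hη
  have hη0 : 0 < η := by positivity
  have hηm : η * (m + 1) = ε / 4 := by rw [hη]; field_simp
  obtain ⟨δ, hδ, hd⟩ := hf η hη0
  refine ⟨min δ (min 1 (ε / (4 * (|L| + 1)))), by positivity, fun {s} hs hst => ?_⟩
  rw [Real.dist_eq] at hst ⊢
  have h1 := hd s hs (hst.trans_le (min_le_left _ _))
  have h2 := hd t ht (by simpa using hδ)
  have h3 : |s - t| < 1 := hst.trans_le ((min_le_right _ _).trans (min_le_left _ _))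
  have h4 : |s - t| < ε / (4 * (|L| + 1)) :=
    hst.trans_le ((min_le_right _ _).trans (min_le_right _ _))
  have h5 : |L * (s - t)| ≤ ε / 4 := by
    rw [abs_mul]
    have : (|L| + 1) * |s - t| ≤ (|L| + 1) * (ε / (4 * (|L| + 1))) := by gcongr
    have h' : (|L| + 1) * (ε / (4 * (|L| + 1))) = ε / 4 := by field_simp
    nlinarith [abs_nonneg (s - t), abs_nonneg L]
  have h6 : |sigma T t - s| ≤ m + 1 := by
    have : sigma T t - s = m + (t - s) := by rw [hm]; ring
    rw [this]
    refine (abs_add_le _ _).trans ?_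
    rw [abs_of_nonneg hm0, abs_sub_comm]
    linarith
  have h7 : |sigma T t - t| ≤ m + 1 := by rw [← hm, abs_of_nonneg hm0]; linarith
  have h8 : η * |sigma T t - s| ≤ ε / 4 := hηm ▸ mul_le_mul_of_nonneg_left h6 hη0.le
  have h9 : η * |sigma T t - t| ≤ ε / 4 := hηm ▸ mul_le_mul_of_nonneg_left h7 hη0.le
  have : f s - f t = (f (sigma T t) - f t - L * (sigma T t - t)) -
      (f (sigma T t) - f s - L * (sigma T t - s)) + L * (s - t) := by ring
  rw [this]
  have h10 := abs_add_le ((f (sigma T t) - f t - L * (sigma T t - t)) -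
      (f (sigma T t) - f s - L * (sigma T t - s))) (L * (s - t))
  have h11 := abs_sub (f (sigma T t) - f t - L * (sigma T t - t))
      (f (sigma T t) - f s - L * (sigma T t - s))
  linarith

/-- A function whose delta derivative vanishes is constant. For every `ε > 0` the set of
`t ∈ T` with `|f t - f c| ≤ ε (t - c)` is closed and, in the time scale, every point of it below
`x` is followed by another one, so that it reaches `x`. -/
lemma eq_of_hasDeltaDerivAt_zero {T : Set ℝ} (hT : IsClosed T) {f : ℝ → ℝ} {c x : ℝ} (hc : c ∈ T)
    (hx : x ∈ T) (hcx : c ≤ x) (hf : ∀ t ∈ kappa T, HasDeltaDerivAt T f 0 t) : f x = f c := by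
  have hcont : ContinuousOn f T := by
    intro t ht
    by_cases hk : t ∈ kappa T
    · exact (hf t hk).continuousWithinAt ht
    · obtain ⟨δ, hδ, hd⟩ := exists_isolated_of_notMem_kappa ht hk
      rw [Metric.continuousWithinAt_iff]
      refine fun ε hε => ⟨δ, hδ, fun {s} hs hst => ?_⟩
      rw [hd s hs hst, dist_self]
      exact hε
  have key : ∀ ε > 0, |f x - f c| ≤ ε * (x - c) := by
    intro ε hε
    have hcl : IsClosed ({t ∈ T | |f t - f c| ≤ ε * (t - c)} ∩ Icc c x) := by
      refine IsClosed.inter ?_ isClosed_Icc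
      exact hT.isClosed_le ((hcont.sub continuousOn_const).abs) (by fun_prop)
    refine (hcl.mem_of_ge_of_forall_exists_gt ⟨hc, by simp⟩ hcx ?_).2
    rintro t ⟨⟨ht, hbt⟩, hct, htx⟩
    obtain ⟨δ, hδ, hd⟩ := hf t (mem_kappa_of_lt ht hx htx) ε hε
    by_cases hσ : sigma T t = t
    · obtain ⟨s, hs, hts, hsδ⟩ := exists_gt_of_rightDense hσ ⟨x, hx, htx⟩
        (lt_min hδ (sub_pos.2 htx))
      have hsδ' : s < t + δ := hsδ.trans_le (by gcongr; exact min_le_left _ _)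
      have hsx : s < t + (x - t) := hsδ.trans_le (by gcongr; exact min_le_right _ _)
      refine ⟨s, ⟨hs, ?_⟩, hts, by linarith⟩
      have h1 := hd s hs (by rw [abs_lt]; constructor <;> linarith)
      rw [hσ, zero_mul, sub_zero, abs_sub_comm t s, abs_of_pos (sub_pos.2 hts), abs_sub_comm] at h1
      have h2 := abs_sub_le (f s) (f t) (f c)
      linarith
    · have hlt : t < sigma T t := lt_of_le_of_ne (le_sigma T t) (Ne.symm hσ)
      refine ⟨sigma T t, ⟨sigma_mem hT ht, ?_⟩, hlt, sigma_le hx htx⟩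
      have h1 := hd t ht (by simpa using hδ)
      rw [zero_mul, sub_zero, abs_of_pos (sub_pos.2 hlt)] at h1
      have h2 := abs_sub_le (f (sigma T t)) (f t) (f c)
      linarith
  have h0 : |f x - f c| ≤ 0 := le_of_forall_pos_le_add fun ε hε => by
    have h1 := key (ε / (x - c + 1)) (by have := sub_nonneg.2 hcx; positivity)
    have h2 : ε / (x - c + 1) * (x - c) ≤ ε := by
      have := sub_nonneg.2 hcx
      rw [div_mul_eq_mul_div, div_le_iff₀ (by linarith)]
      nlinarith
    linarith
  exact sub_eq_zero.1 (abs_nonpos_iff.1 h0)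

/-! ### The last point of a time scale before a real number -/

/-- The last point of `T` that is not after `r`, where numbers before the base point `c` are moved
to `c`. It retracts `ℝ` onto a closed set `T` with least element `c`. -/
noncomputable def lastPoint (T : Set ℝ) (c r : ℝ) : ℝ := sSup (T ∩ Iic (max r c))

section lastPoint

variable {T : Set ℝ} {c : ℝ}

lemma isGreatest_sSup_inter_Iic (hT : IsClosed T) {r : ℝ} (hc : c ∈ T) (hcr : c ≤ r) :
    IsGreatest (T ∩ Iic r) (sSup (T ∩ Iic r)) := by
  have hb : BddAbove (T ∩ Iic r) := ⟨r, fun s hs => hs.2⟩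
  exact ⟨(hT.inter isClosed_Iic).csSup_mem ⟨c, hc, hcr⟩ hb, fun s hs => le_csSup hb hs⟩

lemma isGreatest_lastPoint (hT : IsClosed T) (hc : c ∈ T) (r : ℝ) :
    IsGreatest (T ∩ Iic (max r c)) (lastPoint T c r) :=
  isGreatest_sSup_inter_Iic hT hc (le_max_right _ _)

lemma lastPoint_mem (hT : IsClosed T) (hc : c ∈ T) (r : ℝ) : lastPoint T c r ∈ T :=
  (isGreatest_lastPoint hT hc r).1.1

lemma lastPoint_le (hT : IsClosed T) (hc : c ∈ T) {r s : ℝ} (hrs : r ≤ s) (hcs : c ≤ s) :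
    lastPoint T c r ≤ s :=
  (isGreatest_lastPoint hT hc r).1.2.trans (max_le hrs hcs)

lemma le_lastPoint (hT : IsClosed T) (hc : c ∈ T) {r s : ℝ} (hs : s ∈ T) (hsr : s ≤ r) :
    s ≤ lastPoint T c r :=
  (isGreatest_lastPoint hT hc r).2 ⟨hs, hsr.trans (le_max_left _ _)⟩

lemma base_le_lastPoint (hT : IsClosed T) (hc : c ∈ T) (r : ℝ) : c ≤ lastPoint T c r :=
  (isGreatest_lastPoint hT hc r).2 ⟨hc, mem_Iic.2 (le_max_right _ _)⟩

lemma lastPoint_mono (hT : IsClosed T) (hc : c ∈ T) : Monotone (lastPoint T c) := fun _ _ h =>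
  (isGreatest_lastPoint hT hc _).2
    ⟨lastPoint_mem hT hc _, (isGreatest_lastPoint hT hc _).1.2.trans (max_le_max_right c h)⟩

/-- `lastPoint` is right-continuous in the sense that matters for rd-continuous functions. -/
lemma tendsto_lastPoint (hT : IsClosed T) (hc : c ∈ T) (r : ℝ) :
    Tendsto (lastPoint T c) (𝓝[≥] r) (valueApproach T (lastPoint T c r)) := by
  set t := lastPoint T c r with ht
  have hmono : ∀ r', r ≤ r' → t ≤ lastPoint T c r' := fun r' h => lastPoint_mono hT hc h
  have hct : c ≤ t := base_le_lastPoint hT hc r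
  have hgt : ∀ s ∈ T, t < s → r < s := fun s hs hts => not_le.1 fun hsr =>
    absurd (le_lastPoint hT hc hs hsr) (not_le.2 hts)
  unfold valueApproach
  split_ifs with hσ
  · refine tendsto_nhdsWithin_iff.2 ⟨?_, Eventually.of_forall fun r' => lastPoint_mem hT hc r'⟩
    by_cases hne : (T ∩ Ioi t).Nonempty
    · rw [Metric.tendsto_nhds]
      intro ε hε
      obtain ⟨s, hs, hts, hsε⟩ := exists_gt_of_rightDense hσ hne hε
      filter_upwards [self_mem_nhdsWithin, mem_nhdsWithin_of_mem_nhds (Iio_mem_nhds (hgt s hs hts))]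
        with r' h1 h2
      have h3 := hmono r' h1
      have h4 : lastPoint T c r' ≤ s := lastPoint_le hT hc (le_of_lt h2) (hct.trans hts.le)
      rw [Real.dist_eq, abs_of_nonneg (by linarith)]
      linarith
    · refine tendsto_const_nhds.congr' ?_
      filter_upwards [self_mem_nhdsWithin] with r' h1
      exact le_antisymm (hmono r' h1)
        (not_lt.1 fun h => hne ⟨_, lastPoint_mem hT hc r', h⟩)
  · have hlt : t < sigma T t := lt_of_le_of_ne (le_sigma T t) (Ne.symm hσ)
    have hmem := sigma_mem hT (lastPoint_mem hT hc r)
    rw [tendsto_pure]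
    filter_upwards [self_mem_nhdsWithin, mem_nhdsWithin_of_mem_nhds (Iio_mem_nhds
      (hgt _ hmem hlt))] with r' h1 h2
    refine le_antisymm (not_lt.1 fun h => ?_) (hmono r' h1)
    have h3 := sigma_le (lastPoint_mem hT hc r') h
    have h4 : lastPoint T c r' ≤ max r' c := (isGreatest_lastPoint hT hc r').1.2
    have h5 : max r' c < sigma T t := max_lt h2 (hct.trans_lt hlt)
    linarith

lemma deltaIntegral_eq (f : ℝ → ℝ) {x : ℝ} (hcx : c ≤ x) :
    deltaIntegral T f c x = ∫ r in c..x, f (lastPoint T c r) := by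
  refine intervalIntegral.integral_congr fun r hr => ?_
  rw [uIcc_of_le hcx] at hr
  simp only [lastPoint, max_eq_left hr.1]

end lastPoint

/-! ### Measurability of right-continuous functions -/

lemma tendsto_floor_add_one_div (r : ℝ) :
    Tendsto (fun n : ℕ => ((⌊((n : ℝ) + 1) * r⌋ : ℝ) + 1) / ((n : ℝ) + 1)) atTop (𝓝[≥] r) := by
  have hle : ∀ n : ℕ, r ≤ ((⌊((n : ℝ) + 1) * r⌋ : ℝ) + 1) / ((n : ℝ) + 1) := fun n => by
    rw [le_div_iff₀ (by positivity), mul_comm]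
    exact (Int.lt_floor_add_one _).le
  refine tendsto_nhdsWithin_iff.2 ⟨?_, Eventually.of_forall hle⟩
  have hlim : Tendsto (fun n : ℕ => r + 1 / ((n : ℝ) + 1)) atTop (𝓝 r) := by
    simpa using tendsto_const_nhds.add (tendsto_one_div_add_atTop_nhds_zero_nat (𝕜 := ℝ))
  refine tendsto_of_tendsto_of_tendsto_of_le_of_le tendsto_const_nhds hlim hle fun n => ?_
  have hn : (0 : ℝ) < (n : ℝ) + 1 := by positivity
  have h1 : r + 1 / ((n : ℝ) + 1) = (((n : ℝ) + 1) * r + 1) / ((n : ℝ) + 1) := by field_simp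
  rw [h1]
  gcongr
  exact Int.floor_le _

lemma measurable_of_tendsto_nhdsGE {h : ℝ → ℝ} (hh : ∀ r, Tendsto h (𝓝[≥] r) (𝓝 (h r))) :
    Measurable h := by
  refine measurable_of_tendsto_metrizable (f := fun (n : ℕ) r =>
    h (((⌊((n : ℝ) + 1) * r⌋ : ℝ) + 1) / ((n : ℝ) + 1))) (fun n => ?_) ?_
  · exact (measurable_from_top (f := fun k : ℤ => h (((k : ℝ) + 1) / ((n : ℝ) + 1)))).comp
      (Int.measurable_floor.comp (measurable_const_mul _))
  · exact tendsto_pi_nhds.2 fun r => (hh r).comp (tendsto_floor_add_one_div r)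

lemma measurable_of_tendsto_nhdsGE_prod {h : ℝ × ℝ → ℝ}
    (hh : ∀ p, Tendsto h (𝓝[≥] p.1 ×ˢ 𝓝[≥] p.2) (𝓝 (h p))) : Measurable h := by
  refine measurable_of_tendsto_metrizable (f := fun (n : ℕ) (p : ℝ × ℝ) =>
    h (((⌊((n : ℝ) + 1) * p.1⌋ : ℝ) + 1) / ((n : ℝ) + 1),
      ((⌊((n : ℝ) + 1) * p.2⌋ : ℝ) + 1) / ((n : ℝ) + 1))) (fun n => ?_) ?_
  · have hfl : Measurable fun r : ℝ => ⌊((n : ℝ) + 1) * r⌋ :=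
      Int.measurable_floor.comp (measurable_const_mul _)
    exact (measurable_of_countable (fun k : ℤ × ℤ =>
      h (((k.1 : ℝ) + 1) / ((n : ℝ) + 1), ((k.2 : ℝ) + 1) / ((n : ℝ) + 1)))).comp
      (f := fun p : ℝ × ℝ => (⌊((n : ℝ) + 1) * p.1⌋, ⌊((n : ℝ) + 1) * p.2⌋))
      ((hfl.comp measurable_fst).prodMk (hfl.comp measurable_snd))
  · exact tendsto_pi_nhds.2 fun p => (hh p).comp
      ((tendsto_floor_add_one_div p.1).prodMk (tendsto_floor_add_one_div p.2))

/-! ### Rd-continuity along families of filters -/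

/-- The data that rd-continuity on `X` refers to: a set of points and, for each of them, the
filters along which an rd-continuous function has to have a finite limit. All sets of one
of these filters contain the point itself (`exists_pure`), so that the limit along it is the value of the function.
This makes rd-continuity of functions of several variables a notion that is stable under
products of domains (`RdDomain.prod`). -/
structure RdDomain (X : Type*) where
  /-- the points of the domain -/
  carrier : Set X
  /-- the ways of approaching a point -/
  approach : X → Set (Filter X)
  countable : ∀ t, ∀ l ∈ approach t, l.IsCountablyGenerated
  le_principal : ∀ t ∈ carrier, ∀ l ∈ approach t, l ≤ 𝓟 carrier
  exists_pure : ∀ t ∈ carrier, ∃ l ∈ approach t, pure t ≤ l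

lemma pure_le_valueApproach {T : Set ℝ} {t : ℝ} (ht : t ∈ T) : pure t ≤ valueApproach T t := by
  unfold valueApproach
  split_ifs
  · exact pure_le_nhdsWithin ht
  · exact le_rfl

lemma valueApproach_le {T : Set ℝ} {t : ℝ} (ht : t ∈ T) : valueApproach T t ≤ 𝓝[T] t := by
  unfold valueApproach
  split_ifs
  · exact le_rfl
  · exact pure_le_nhdsWithin ht

lemma leftApproach_le (T : Set ℝ) (t : ℝ) : leftApproach T t ≤ 𝓝[T] t :=
  nhdsWithin_mono _ inter_subset_left

/-- The two approaches to a point of a time scale cover all of its neighbourhood in the time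
scale. -/
lemma nhdsWithin_le_sup (T : Set ℝ) (t : ℝ) :
    𝓝[T] t ≤ leftApproach T t ⊔ valueApproach T t := by
  unfold leftApproach valueApproach
  split_ifs with h
  · exact le_sup_right
  · have hlt : t < sigma T t := lt_of_le_of_ne (le_sigma T t) (Ne.symm h)
    rw [← nhdsWithin_singleton, ← nhdsWithin_union]
    refine nhdsWithin_le_iff.2 ?_
    filter_upwards [self_mem_nhdsWithin, mem_nhdsWithin_of_mem_nhds (Iio_mem_nhds hlt)] with s h1 h2
    rcases lt_trichotomy s t with h3 | h3 | h3
    · exact Or.inl ⟨h1, h3⟩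
    · exact Or.inr h3
    · exact absurd (sigma_le h1 h3) (not_le.2 h2)

/-- The domain of rd-continuous functions of one time scale variable. -/
def RdDomain.ofSet (T : Set ℝ) : RdDomain ℝ where
  carrier := T
  approach t := {leftApproach T t, valueApproach T t}
  countable := by
    rintro t l (rfl | rfl)
    · unfold leftApproach; infer_instance
    · unfold valueApproach; split_ifs <;> infer_instance
  le_principal := by
    rintro t ht l (rfl | rfl)
    · exact (leftApproach_le T t).trans inf_le_right
    · exact (valueApproach_le ht).trans inf_le_right
  exists_pure := fun t ht => ⟨valueApproach T t, Or.inr rfl, pure_le_valueApproach ht⟩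

lemma RdDomain.approach_ofSet_le {T : Set ℝ} {t : ℝ} (ht : t ∈ T) {l : Filter ℝ}
    (hl : l ∈ (RdDomain.ofSet T).approach t) : l ≤ 𝓝[T] t := by
  rcases hl with rfl | rfl
  · exact leftApproach_le T t
  · exact valueApproach_le ht

section

variable {X Y Z E E' : Type*}

/-- The product domain: each variable approaches its value in one of its own ways. -/
def RdDomain.prod (D : RdDomain X) (D' : RdDomain Y) : RdDomain (X × Y) where
  carrier := D.carrier ×ˢ D'.carrier
  approach t := image2 (fun l l' => l ×ˢ l') (D.approach t.1) (D'.approach t.2)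
  countable := by
    rintro t _ ⟨l, hl, l', hl', rfl⟩
    have := D.countable _ l hl
    have := D'.countable _ l' hl'
    infer_instance
  le_principal := by
    rintro t ht _ ⟨l, hl, l', hl', rfl⟩
    rw [← prod_principal_principal]
    exact Filter.prod_mono (D.le_principal _ ht.1 l hl) (D'.le_principal _ ht.2 l' hl')
  exists_pure := by
    rintro t ht
    obtain ⟨l, hl, h⟩ := D.exists_pure _ ht.1
    obtain ⟨l', hl', h'⟩ := D'.exists_pure _ ht.2
    refine ⟨_, mem_image2_of_mem hl hl', ?_⟩
    have : (pure t : Filter (X × Y)) =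
      (pure t.1 : Filter X) ×ˢ (pure t.2 : Filter Y) := by simp
    rw [this]
    exact Filter.prod_mono h h'

/-- Rd-continuity on an `RdDomain`. -/
def RdCont [TopologicalSpace E] (D : RdDomain X) (f : X → E) : Prop :=
  ∀ t ∈ D.carrier, ∀ l ∈ D.approach t, ∃ L, Tendsto f l (𝓝 L)

/-- A map that is compatible with the approaches of two domains. -/
def RdMap (D : RdDomain X) (D' : RdDomain Y) (φ : X → Y) : Prop :=
  ∀ t ∈ D.carrier, φ t ∈ D'.carrier ∧
    ∀ l ∈ D.approach t, ∃ l' ∈ D'.approach (φ t), Tendsto φ l l'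

section RdMap

variable {D : RdDomain X} {D' : RdDomain Y} {D'' : RdDomain Z}

lemma rdMap_id : RdMap D D (fun x => x) := fun _ ht => ⟨ht, fun l hl => ⟨l, hl, tendsto_id⟩⟩

lemma RdMap.fst {φ : X → Y × Z} (h : RdMap D (D'.prod D'') φ) : RdMap D D' (fun x => (φ x).1) := by
  refine fun t ht => ⟨(h t ht).1.1, fun l hl => ?_⟩
  obtain ⟨_, ⟨l', hl', l'', hl'', rfl⟩, hφ⟩ := (h t ht).2 l hl
  exact ⟨l', hl', tendsto_fst.comp hφ⟩

lemma RdMap.snd {φ : X → Y × Z} (h : RdMap D (D'.prod D'') φ) :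
    RdMap D D'' (fun x => (φ x).2) := by
  refine fun t ht => ⟨(h t ht).1.2, fun l hl => ?_⟩
  obtain ⟨_, ⟨l', hl', l'', hl'', rfl⟩, hφ⟩ := (h t ht).2 l hl
  exact ⟨l'', hl'', tendsto_snd.comp hφ⟩

lemma RdMap.prodMk {φ : X → Y} {ψ : X → Z} (hφ : RdMap D D' φ) (hψ : RdMap D D'' ψ) :
    RdMap D (D'.prod D'') (fun x => (φ x, ψ x)) := by
  refine fun t ht => ⟨⟨(hφ t ht).1, (hψ t ht).1⟩, fun l hl => ?_⟩
  obtain ⟨l', hl', h'⟩ := (hφ t ht).2 l hl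
  obtain ⟨l'', hl'', h''⟩ := (hψ t ht).2 l hl
  exact ⟨_, mem_image2_of_mem hl' hl'', h'.prodMk h''⟩

lemma rdMap_const {y : Y} (hy : y ∈ D'.carrier) : RdMap D D' (fun _ => y) := by
  obtain ⟨l', hl', h⟩ := D'.exists_pure y hy
  exact fun t ht => ⟨hy, fun l hl => ⟨l', hl', tendsto_const_pure.mono_right h⟩⟩

end RdMap

section RdCont

variable {D : RdDomain X} {D' : RdDomain Y} [TopologicalSpace E] [TopologicalSpace E']

lemma RdCont.comp {f : Y → E} (hf : RdCont D' f) {φ : X → Y} (hφ : RdMap D D' φ) :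
    RdCont D (fun x => f (φ x)) := by
  intro t ht l hl
  obtain ⟨l', hl', h⟩ := (hφ t ht).2 l hl
  obtain ⟨L, hL⟩ := hf _ (hφ t ht).1 l' hl'
  exact ⟨L, hL.comp h⟩

lemma RdCont.tendsto_value [T2Space E] {f : X → E} (hf : RdCont D f) {t : X} (ht : t ∈ D.carrier)
    {l : Filter X} (hl : l ∈ D.approach t) (hpure : pure t ≤ l) : Tendsto f l (𝓝 (f t)) := by
  obtain ⟨L, hL⟩ := hf t ht l hl
  have h : Tendsto f (pure t) (𝓝 L) := hL.mono_left hpure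
  have h' : Tendsto f (pure t) (𝓝 (f t)) := tendsto_pure_nhds f t
  rwa [tendsto_nhds_unique h' h]

lemma RdCont.congr {f g : X → E} (hf : RdCont D f) (h : EqOn f g D.carrier) : RdCont D g := by
  intro t ht l hl
  obtain ⟨L, hL⟩ := hf t ht l hl
  exact ⟨L, hL.congr' (D.le_principal t ht l hl h)⟩

lemma rdCont_const (y : E) : RdCont D (fun _ => y) := fun _ _ _ _ => ⟨y, tendsto_const_nhds⟩

lemma RdCont.prodMk {f : X → E} {g : X → E'} (hf : RdCont D f) (hg : RdCont D g) :
    RdCont D (fun x => (f x, g x)) := by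
  intro t ht l hl
  obtain ⟨L, hL⟩ := hf t ht l hl
  obtain ⟨L', hL'⟩ := hg t ht l hl
  exact ⟨(L, L'), hL.prodMk_nhds hL'⟩

lemma _root_.Continuous.comp_rdCont {φ : E → E'} (hφ : Continuous φ) {f : X → E} (hf : RdCont D f) :
    RdCont D (fun x => φ (f x)) := by
  intro t ht l hl
  obtain ⟨L, hL⟩ := hf t ht l hl
  exact ⟨φ L, (hφ.tendsto L).comp hL⟩

lemma RdCont.add {f g : X → ℝ} (hf : RdCont D f) (hg : RdCont D g) :
    RdCont D (fun x => f x + g x) := continuous_add.comp_rdCont (hf.prodMk hg)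

lemma RdCont.sub {f g : X → ℝ} (hf : RdCont D f) (hg : RdCont D g) :
    RdCont D (fun x => f x - g x) := continuous_sub.comp_rdCont (hf.prodMk hg)

lemma RdCont.mul {f g : X → ℝ} (hf : RdCont D f) (hg : RdCont D g) :
    RdCont D (fun x => f x * g x) := continuous_mul.comp_rdCont (hf.prodMk hg)

lemma RdCont.abs {f : X → ℝ} (hf : RdCont D f) : RdCont D (fun x => |f x|) :=
  continuous_abs.comp_rdCont hf

lemma rdCont_pi {ι : Type*} {f : X → ι → E} (hf : ∀ i, RdCont D (fun x => f x i)) :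
    RdCont D f := by
  intro t ht l hl
  choose L hL using fun i => hf i t ht l hl
  exact ⟨L, tendsto_pi_nhds.2 hL⟩

/-- Substitution of an rd-continuous function into the real variables. -/
lemma RdCont.subst {f : X → E → E'}
    (hf : ∀ t ∈ D.carrier, ∀ l ∈ D.approach t, ∀ p : E, ∃ L,
      Tendsto (fun w : X × E => f w.1 w.2) (l ×ˢ 𝓝 p) (𝓝 L))
    {g : X → E} (hg : RdCont D g) : RdCont D (fun x => f x (g x)) := by
  intro t ht l hl
  obtain ⟨p, hp⟩ := hg t ht l hl
  obtain ⟨L, hL⟩ := hf t ht l hl p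
  exact ⟨L, hL.comp (tendsto_id.prodMk hp)⟩

/-- Rd-continuity is inherited by limits that are uniform with respect to an rd-continuous
weight. -/
lemma RdCont.of_weighted_limit {f : ℕ → X → ℝ} {g e : X → ℝ} {r : ℕ → ℝ}
    (hf : ∀ n, RdCont D (f n)) (he : RdCont D e) (hr : Tendsto r atTop (𝓝 0))
    (h : ∀ n, ∀ x ∈ D.carrier, |f n x - g x| ≤ r n * e x) : RdCont D g := by
  intro t ht l hl
  rcases l.eq_or_neBot with rfl | hne
  · exact ⟨0, tendsto_bot⟩
  obtain ⟨B, hB⟩ := he t ht l hl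
  refine cauchy_map_iff_exists_tendsto.1 (Metric.cauchy_iff.2 ⟨inferInstance, fun ε hε => ?_⟩)
  have hlim : Tendsto (fun n => |r n| * (|B| + 1)) atTop (𝓝 0) := by
    simpa using hr.abs.mul_const (|B| + 1)
  obtain ⟨n, hn⟩ := (hlim.eventually (gt_mem_nhds (show 0 < ε / 4 by linarith))).exists
  obtain ⟨L, hL⟩ := hf n t ht l hl
  have h1 : ∀ᶠ x in l, |e x| < |B| + 1 := hB.abs.eventually (gt_mem_nhds (by linarith))
  have h2 : ∀ᶠ x in l, |f n x - L| < ε / 4 :=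
    (Metric.tendsto_nhds.1 hL (ε / 4) (by linarith))
  have h3 : ∀ᶠ x in l, x ∈ D.carrier := D.le_principal t ht l hl (mem_principal_self _)
  refine ⟨g '' {x | |g x - L| < ε / 2}, image_mem_map ?_, ?_⟩
  · filter_upwards [h1, h2, h3] with x hx1 hx2 hx3
    have h4 : |f n x - g x| < ε / 4 := by
      refine ((h n x hx3).trans ?_).trans_lt hn
      calc r n * e x ≤ |r n * e x| := le_abs_self _
        _ = |r n| * |e x| := abs_mul _ _
        _ ≤ _ := by gcongr
    have h5 := abs_sub_le (g x) (f n x) L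
    rw [abs_sub_comm (g x) (f n x)] at h5
    show |g x - L| < ε / 2
    linarith
  · rintro _ ⟨x, hx, rfl⟩ _ ⟨y, hy, rfl⟩
    rw [Real.dist_eq]
    have h5 := abs_sub_le (g x) L (g y)
    rw [abs_sub_comm L (g y)] at h5
    have hx' : |g x - L| < ε / 2 := hx
    have hy' : |g y - L| < ε / 2 := hy
    linarith

/-- The definition `RdContinuous` in terms of `RdDomain`, with its arguments given by any functions
that are admissible in each coordinate. -/
lemma RdContinuous.exists_tendsto {n m : ℕ} {T : Fin n → Set ℝ}
    {f : (Fin n → ℝ) → (Fin m → ℝ) → ℝ} (hf : RdContinuous T f) {φ : X → Fin n → ℝ}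
    (hφ : ∀ i, RdMap D (RdDomain.ofSet (T i)) (fun x => φ x i)) :
    ∀ t ∈ D.carrier, ∀ l ∈ D.approach t, ∀ p : Fin m → ℝ, ∃ L,
      Tendsto (fun w : X × (Fin m → ℝ) => f (φ w.1) w.2) (l ×ˢ 𝓝 p) (𝓝 L) := by
  classical
  intro t ht l hl p
  choose l' hl' hlim using fun i => (hφ i t ht).2 l hl
  obtain ⟨L, hL⟩ := (hf (φ t) (fun i => (hφ i t ht).1) p).2
    (Finset.univ.filter fun i => l' i = leftApproach (T i) (φ t i))
  refine ⟨L, hL.comp (f := fun w : X × (Fin m → ℝ) => (φ w.1, w.2)) ?_⟩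
  refine Tendsto.prodMk (tendsto_pi.2 fun i => ?_) tendsto_snd
  refine ((hlim i).comp tendsto_fst).mono_right ?_
  by_cases h : l' i = leftApproach (T i) (φ t i)
  · simp [h]
  · simpa [h] using le_of_eq ((hl' i).resolve_left h)

lemma RdContinuous.rdCont {n : ℕ} {T : Fin n → Set ℝ} {f : (Fin n → ℝ) → ℝ}
    (hf : RdContinuous (m := 0) T (fun t _ => f t)) {φ : X → Fin n → ℝ}
    (hφ : ∀ i, RdMap D (RdDomain.ofSet (T i)) (fun x => φ x i)) : RdCont D (fun x => f (φ x)) :=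
  RdCont.subst (E := Fin 0 → ℝ) (f := fun x _ => f (φ x)) (hf.exists_tendsto hφ)
    (rdCont_const 0)

end RdCont

/-- `T × T' × T''` as a domain. -/
def RdDomain.triple (T T' T'' : Set ℝ) : RdDomain (ℝ × ℝ × ℝ) :=
  (RdDomain.ofSet T).prod ((RdDomain.ofSet T').prod (RdDomain.ofSet T''))

lemma RdCont.rdContinuous₃ {T T' T'' : Set ℝ} {f : ℝ → ℝ → ℝ → ℝ}
    (hf : RdCont (RdDomain.triple T T' T'') (fun x => f x.1 x.2.1 x.2.2)) :
    RdContinuous₃ T T' T'' f := by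
  classical
  intro t ht p
  have hlim : ∀ l : Fin 3 → Filter ℝ, Tendsto (fun w : (Fin 3 → ℝ) × (Fin 0 → ℝ) =>
      (w.1 0, w.1 1, w.1 2)) (Filter.pi l ×ˢ 𝓝 p) (l 0 ×ˢ l 1 ×ˢ l 2) := fun l =>
    (((tendsto_eval_pi l 0).prodMk ((tendsto_eval_pi l 1).prodMk (tendsto_eval_pi l 2)))).comp
      tendsto_fst
  have hmem : (t 0, t 1, t 2) ∈ (RdDomain.triple T T' T'').carrier := ⟨ht 0, ht 1, ht 2⟩
  constructor
  · have h := hf.tendsto_value hmem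
      (mem_image2_of_mem (Or.inr rfl) (mem_image2_of_mem (Or.inr rfl) (Or.inr rfl)))
      (l := valueApproach T (t 0) ×ˢ valueApproach T' (t 1) ×ˢ valueApproach T'' (t 2)) (by
        have : (pure (t 0, t 1, t 2) : Filter (ℝ × ℝ × ℝ)) =
          (pure (t 0) : Filter ℝ) ×ˢ (pure (t 1) : Filter ℝ) ×ˢ (pure (t 2) : Filter ℝ) := by simp
        rw [this]
        exact Filter.prod_mono (pure_le_valueApproach (ht 0))
          (Filter.prod_mono (pure_le_valueApproach (ht 1)) (pure_le_valueApproach (ht 2))))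
    exact h.comp (hlim fun i => valueApproach ((![T, T', T''] : Fin 3 → Set ℝ) i) (t i))
  · intro A
    set l : Fin 3 → Filter ℝ := fun i => if i ∈ A then leftApproach (![T, T', T''] i) (t i)
          else valueApproach (![T, T', T''] i) (t i) with hl
    have hap : ∀ i, l i ∈ (RdDomain.ofSet (![T, T', T''] i)).approach (t i) := by
      intro i
      simp only [hl]
      split_ifs
      · exact Or.inl rfl
      · exact Or.inr rfl
    obtain ⟨L, hL⟩ := hf _ hmem _
      (mem_image2_of_mem (hap 0) (mem_image2_of_mem (hap 1) (hap 2)))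
    exact ⟨L, hL.comp (hlim l)⟩

lemma _root_.ContinuousOn.rdCont {T : Set ℝ} {f : ℝ → ℝ} (hf : ContinuousOn f T) :
    RdCont (RdDomain.ofSet T) f := fun t ht _ hl =>
  ⟨f t, (hf t ht).mono_left (RdDomain.approach_ofSet_le ht hl)⟩

/-- The indicator function of `T^κ` is rd-continuous, because the only point of `T` that may be
missing from `T^κ` is isolated. -/
lemma rdCont_indicator_kappa (T : Set ℝ) :
    RdCont (RdDomain.ofSet T) ((kappa T).indicator fun _ => (1 : ℝ)) := by
  refine ContinuousOn.rdCont fun t ht => ?_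
  by_cases hk : t ∈ kappa T
  · -- a greatest element of `T` different from `t` is avoided near `t`
    have hev : ∀ᶠ s in 𝓝[T] t, s ∈ kappa T := by
      by_cases hmax : ∃ m, IsGreatest T m ∧ rho T m < m
      · obtain ⟨m, hm, hrho⟩ := hmax
        have htm : t < m := lt_of_le_of_ne (hm.2 ht) fun h => hk.2 (h ▸ ⟨hm, hrho⟩)
        filter_upwards [self_mem_nhdsWithin, mem_nhdsWithin_of_mem_nhds (Iio_mem_nhds htm)]
          with s h1 h2
        exact mem_kappa_of_lt h1 hm.1 h2
      · filter_upwards [self_mem_nhdsWithin] with s hs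
        exact ⟨hs, fun h => hmax ⟨s, h⟩⟩
    refine tendsto_const_nhds.congr' ?_
    filter_upwards [hev] with s hs
    rw [indicator_of_mem hs, indicator_of_mem hk]
  · obtain ⟨δ, hδ, hd⟩ := exists_isolated_of_notMem_kappa ht hk
    refine tendsto_const_nhds.congr' ?_
    filter_upwards [self_mem_nhdsWithin, mem_nhdsWithin_of_mem_nhds (Metric.ball_mem_nhds t hδ)]
      with s h1 h2
    rw [hd s h1 h2]

end

/-! ### Delta integrals of rd-continuous functions -/

section

variable {X : Type*} {D : RdDomain X} {T T' : Set ℝ} {c c' : ℝ}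

lemma rdMap_slice {p : X} (hp : p ∈ D.carrier) :
    RdMap (RdDomain.ofSet T) (D.prod (RdDomain.ofSet T)) (fun τ => (p, τ)) :=
  (rdMap_const hp).prodMk rdMap_id

/-- Rd-continuous functions are locally bounded, uniformly on compact sets of the last variable. -/
lemma RdCont.eventually_bound {g : X × ℝ → ℝ} (hg : RdCont (D.prod (RdDomain.ofSet T)) g)
    (hT : IsClosed T) {t : X} (ht : t ∈ D.carrier) {l : Filter X} (hl : l ∈ D.approach t)
    (c d : ℝ) :
    ∃ C, ∀ᶠ p in l, ∀ τ ∈ T ∩ Icc c d, |g (p, τ)| ≤ C := by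
  have hK : IsCompact (T ∩ Icc c d) := isCompact_Icc.inter_left hT
  refine hK.induction_on (p := fun s => ∃ C, ∀ᶠ p in l, ∀ τ ∈ s, |g (p, τ)| ≤ C) ?_ ?_ ?_ ?_
  · exact ⟨0, by simp⟩
  · rintro s s' hss' ⟨C, hC⟩
    exact ⟨C, hC.mono fun p hp τ hτ => hp τ (hss' hτ)⟩
  · rintro s s' ⟨C, hC⟩ ⟨C', hC'⟩
    refine ⟨max C C', (hC.and hC').mono fun p hp τ hτ => ?_⟩
    rcases hτ with hτ | hτ
    · exact (hp.1 τ hτ).trans (le_max_left _ _)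
    · exact (hp.2 τ hτ).trans (le_max_right _ _)
  · intro τ hτ
    have key : ∀ m ∈ (RdDomain.ofSet T).approach τ, ∃ C, ∃ s ∈ m, ∀ᶠ p in l, ∀ r ∈ s,
        |g (p, r)| ≤ C := by
      intro m hm
      obtain ⟨L, hL⟩ := hg (t, τ) ⟨ht, hτ.1⟩ _ (mem_image2_of_mem hl hm)
      have hev : ∀ᶠ w in l ×ˢ m, |g w| ≤ |L| + 1 :=
        (hL.abs.eventually (gt_mem_nhds (by linarith : |L| < |L| + 1))).mono fun w hw => le_of_lt hw
      obtain ⟨pa, ha, pb, hb, hab⟩ := eventually_prod_iff.1 hev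
      exact ⟨|L| + 1, {r | pb r}, hb, ha.mono fun p hp r hr => hab hp hr⟩
    obtain ⟨C, s, hs, hC⟩ := key _ (Or.inl rfl)
    obtain ⟨C', s', hs', hC'⟩ := key _ (Or.inr rfl)
    refine ⟨s ∪ s', ?_, max C C', (hC.and hC').mono fun p hp r hr => ?_⟩
    · refine nhdsWithin_mono _ inter_subset_left (nhdsWithin_le_sup T τ ?_)
      exact ⟨mem_of_superset hs subset_union_left, mem_of_superset hs' subset_union_right⟩
    · rcases hr with hr | hr
      · exact (hp.1 r hr).trans (le_max_left _ _)
      · exact (hp.2 r hr).trans (le_max_right _ _)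

lemma RdCont.exists_bound {f : ℝ → ℝ} (hf : RdCont (RdDomain.ofSet T) f) (hT : IsClosed T)
    (hc : c ∈ T) (d : ℝ) : ∃ C, ∀ τ ∈ T ∩ Icc c d, |f τ| ≤ C := by
  have hg : RdCont ((RdDomain.ofSet T).prod (RdDomain.ofSet T)) (fun w => f w.2) :=
    hf.comp rdMap_id.snd
  obtain ⟨l, hl, hpure⟩ := (RdDomain.ofSet T).exists_pure c hc
  obtain ⟨C, hC⟩ := hg.eventually_bound hT hc hl c d
  exact ⟨C, eventually_pure.1 (hC.filter_mono hpure)⟩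

lemma RdCont.tendsto_valueApproach {f : ℝ → ℝ} (hf : RdCont (RdDomain.ofSet T) f) {t : ℝ}
    (ht : t ∈ T) : Tendsto f (valueApproach T t) (𝓝 (f t)) :=
  hf.tendsto_value ht (Or.inr rfl) (pure_le_valueApproach ht)

lemma RdCont.measurable_lastPoint {f : ℝ → ℝ} (hf : RdCont (RdDomain.ofSet T) f) (hT : IsClosed T)
    (hc : c ∈ T) : Measurable fun r => f (lastPoint T c r) :=
  measurable_of_tendsto_nhdsGE fun r =>
    (hf.tendsto_valueApproach (lastPoint_mem hT hc r)).comp (tendsto_lastPoint hT hc r)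

lemma RdCont.intervalIntegrable {f : ℝ → ℝ} (hf : RdCont (RdDomain.ofSet T) f) (hT : IsClosed T)
    (hc : c ∈ T) (x y : ℝ) : IntervalIntegrable (fun r => f (lastPoint T c r)) volume x y := by
  obtain ⟨C, hC⟩ := hf.exists_bound hT hc (max (max x y) c)
  rw [intervalIntegrable_iff]
  refine Measure.integrableOn_of_bounded (M := C) (by simp [uIoc])
    (hf.measurable_lastPoint hT hc).aestronglyMeasurable ?_
  refine (ae_restrict_iff' measurableSet_uIoc).2 (Eventually.of_forall fun r hr => ?_)
  exact hC _ ⟨lastPoint_mem hT hc r, base_le_lastPoint hT hc r,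
    lastPoint_le hT hc (hr.2.trans (le_max_left _ _)) (le_max_right _ _)⟩

lemma lastPoint_mem_Icc (hT : IsClosed T) (hc : c ∈ T) {x r : ℝ} (hr : r ∈ Icc c x) :
    lastPoint T c r ∈ Icc c x :=
  ⟨base_le_lastPoint hT hc r, lastPoint_le hT hc hr.2 (hr.1.trans hr.2)⟩

/-- The delta integral over `[c, x]` does not see the value of the integrand at `x`. -/
lemma deltaIntegral_congr (hT : IsClosed T) (hc : c ∈ T) {f g : ℝ → ℝ} {x : ℝ} (hcx : c ≤ x)
    (h : ∀ t ∈ T, c ≤ t → t < x → f t = g t) : deltaIntegral T f c x = deltaIntegral T g c x := by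
  rw [deltaIntegral_eq f hcx, deltaIntegral_eq g hcx]
  refine intervalIntegral.integral_congr_ae ?_
  have hne : ∀ᵐ r : ℝ, r ≠ x := by simp [ae_iff]
  filter_upwards [hne] with r hr hrx
  rw [uIoc_of_le hcx] at hrx
  have hlt : r < x := lt_of_le_of_ne hrx.2 hr
  exact h _ (lastPoint_mem hT hc r) (base_le_lastPoint hT hc r)
    ((lastPoint_le hT hc le_rfl hrx.1.le).trans_lt hlt)

lemma deltaIntegral_self (f : ℝ → ℝ) : deltaIntegral T f c c = 0 :=
  intervalIntegral.integral_same

lemma deltaIntegral_const_mul (f : ℝ → ℝ) (k x : ℝ) :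
    deltaIntegral T (fun t => k * f t) c x = k * deltaIntegral T f c x :=
  intervalIntegral.integral_const_mul _ _

lemma deltaIntegral_add (hT : IsClosed T) (hc : c ∈ T) {f g : ℝ → ℝ} {x : ℝ} (hcx : c ≤ x)
    (hf : RdCont (RdDomain.ofSet T) f) (hg : RdCont (RdDomain.ofSet T) g) :
    deltaIntegral T (fun t => f t + g t) c x = deltaIntegral T f c x + deltaIntegral T g c x := by
  simp only [deltaIntegral_eq _ hcx]
  exact intervalIntegral.integral_add (hf.intervalIntegrable hT hc _ _)
    (hg.intervalIntegrable hT hc _ _)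

lemma deltaIntegral_sub (hT : IsClosed T) (hc : c ∈ T) {f g : ℝ → ℝ} {x : ℝ} (hcx : c ≤ x)
    (hf : RdCont (RdDomain.ofSet T) f) (hg : RdCont (RdDomain.ofSet T) g) :
    deltaIntegral T (fun t => f t - g t) c x = deltaIntegral T f c x - deltaIntegral T g c x := by
  simp only [deltaIntegral_eq _ hcx]
  exact intervalIntegral.integral_sub (hf.intervalIntegrable hT hc _ _)
    (hg.intervalIntegrable hT hc _ _)

lemma abs_deltaIntegral_le (hT : IsClosed T) (hc : c ∈ T) {f g : ℝ → ℝ} {x : ℝ} (hcx : c ≤ x)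
    (hg : RdCont (RdDomain.ofSet T) g) (h : ∀ t ∈ T, c ≤ t → t ≤ x → |f t| ≤ g t) :
    |deltaIntegral T f c x| ≤ deltaIntegral T g c x := by
  simp only [deltaIntegral_eq _ hcx]
  rw [← Real.norm_eq_abs]
  refine intervalIntegral.norm_integral_le_of_norm_le hcx ?_ (hg.intervalIntegrable hT hc _ _)
  refine Eventually.of_forall fun r hr => ?_
  have h1 := lastPoint_mem_Icc hT hc (Ioc_subset_Icc_self hr)
  exact h _ (lastPoint_mem hT hc r) h1.1 h1.2

/-- Delta integrals over `[a, b]` may be formed in `T ∩ [a, b]`. -/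
lemma deltaIntegral_inter_Icc (hT : IsClosed T) {a b : ℝ} (ha : a ∈ T) (hab : a ≤ b) (f : ℝ → ℝ) :
    deltaIntegral T f a b = deltaIntegral (T ∩ Icc a b) f a b := by
  refine intervalIntegral.integral_congr fun r hr => ?_
  rw [uIcc_of_le hab] at hr
  have h := isGreatest_sSup_inter_Iic hT ha hr.1
  have h' : IsGreatest (T ∩ Icc a b ∩ Iic r) (sSup (T ∩ Iic r)) :=
    ⟨⟨⟨h.1.1, h.2 ⟨ha, hr.1⟩, h.1.2.trans hr.2⟩, h.1.2⟩, fun s hs => h.2 ⟨hs.1.1, hs.2⟩⟩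
  simp only [h'.csSup_eq]

/-- The fundamental theorem of calculus. -/
lemma hasDeltaDerivAt_deltaIntegral (hT : IsClosed T) (hc : IsLeast T c) {f : ℝ → ℝ}
    (hf : RdCont (RdDomain.ofSet T) f) {t : ℝ} (ht : t ∈ T) :
    HasDeltaDerivAt T (fun x => deltaIntegral T f c x) (f t) t := by
  have hσc : c ≤ sigma T t := hc.2 (sigma_mem hT ht)
  -- the error in the definition is the integral of `f - f t` between `s` and `σ t`
  have hdiff : ∀ s ∈ T, deltaIntegral T f c (sigma T t) - deltaIntegral T f c s -
      f t * (sigma T t - s) = ∫ r in s..sigma T t, (f (lastPoint T c r) - f t) := by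
    intro s hs
    have hi := hf.intervalIntegrable hT hc.1
    rw [deltaIntegral_eq _ hσc, deltaIntegral_eq _ (hc.2 hs),
      intervalIntegral.integral_interval_sub_left (hi _ _) (hi _ _),
      intervalIntegral.integral_sub (hi _ _) (by simp), intervalIntegral.integral_const]
    simp [mul_comm]
  intro ε hε
  have hval := hf.tendsto_valueApproach ht
  by_cases hσ : sigma T t = t
  · rw [valueApproach, if_pos hσ, Metric.tendsto_nhdsWithin_nhds] at hval
    obtain ⟨δ, hδ, hd⟩ := hval ε hε
    refine ⟨δ, hδ, fun s hs hsδ => ?_⟩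
    rw [hdiff s hs, hσ, ← Real.norm_eq_abs]
    refine intervalIntegral.norm_integral_le_of_norm_le_const fun r hr => ?_
    refine (hd (lastPoint_mem hT hc.1 r) ?_).le
    -- `lastPoint r` lies between `s` and `t` since `r` does
    have h1 : lastPoint T c r ≤ max s t := lastPoint_le hT hc.1 (uIoc_subset_uIcc hr).2
      ((hc.2 ht).trans (le_max_right _ _))
    have h2 : min s t ≤ lastPoint T c r := le_lastPoint hT hc.1
      (by rcases min_choice s t with h | h <;> rw [h] <;> assumption) (uIoc_subset_uIcc hr).1
    rw [Real.dist_eq]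
    rw [abs_lt] at hsδ ⊢
    rcases le_total s t with hst | hst
    · rw [min_eq_left hst] at h2
      rw [max_eq_right hst] at h1
      constructor <;> linarith
    · rw [min_eq_right hst] at h2
      rw [max_eq_left hst] at h1
      constructor <;> linarith
  · have hlt : t < sigma T t := lt_of_le_of_ne (le_sigma T t) (Ne.symm hσ)
    obtain ⟨C, hC⟩ := hf.exists_bound hT hc.1 t
    have hC0 : 0 ≤ C := (abs_nonneg _).trans (hC t ⟨ht, hc.2 ht, le_rfl⟩)
    set μ := sigma T t - t with hμ
    have hμ0 : 0 < μ := sub_pos.2 hlt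
    refine ⟨min μ (ε * μ / (2 * C + 1)), by positivity, fun s hs hsδ => ?_⟩
    have hsμ : |s - t| < μ := hsδ.trans_le (min_le_left _ _)
    have hst : s ≤ t := not_lt.1 fun h => by
      have := sigma_le hs h
      rw [abs_lt] at hsμ
      linarith
    have hsε : (2 * C) * (t - s) ≤ ε * μ := by
      have h1 : |s - t| < ε * μ / (2 * C + 1) := hsδ.trans_le (min_le_right _ _)
      rw [lt_div_iff₀ (by positivity), abs_sub_comm, abs_of_nonneg (by linarith)] at h1
      nlinarith
    rw [hdiff s hs]
    have hi : ∀ x y, IntervalIntegrable (fun r => f (lastPoint T c r) - f t) volume x y :=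
      fun x y => (hf.intervalIntegrable hT hc.1 x y).sub (by simp)
    rw [← intervalIntegral.integral_add_adjacent_intervals (hi s t) (hi t _)]
    have hzero : ∫ r in t..sigma T t, (f (lastPoint T c r) - f t) = 0 := by
      have hne : ∀ᵐ r : ℝ, r ≠ sigma T t := by simp [ae_iff]
      rw [← intervalIntegral.integral_zero (a := t) (b := sigma T t) (μ := volume)]
      refine intervalIntegral.integral_congr_ae ?_
      filter_upwards [hne] with r hr hrt
      rw [uIoc_of_le hlt.le] at hrt
      have h1 : lastPoint T c r = t := by
        refine le_antisymm (not_lt.1 fun h => ?_) (le_lastPoint hT hc.1 ht hrt.1.le)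
        have h2 := sigma_le (lastPoint_mem hT hc.1 r) h
        have h3 := lastPoint_le hT hc.1 (le_refl r) ((hc.2 ht).trans hrt.1.le)
        exact hr (le_antisymm hrt.2 (h2.trans h3))
      rw [h1, sub_self]
    rw [hzero, add_zero]
    have hbound : ∀ r ∈ uIoc s t, ‖f (lastPoint T c r) - f t‖ ≤ 2 * C := by
      intro r hr
      rw [uIoc_of_le hst] at hr
      have h1 := hC _ ⟨lastPoint_mem hT hc.1 r, base_le_lastPoint hT hc.1 r,
        lastPoint_le hT hc.1 hr.2 (hc.2 ht)⟩
      have h2 := hC t ⟨ht, hc.2 ht, le_rfl⟩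
      refine (norm_sub_le _ _).trans ?_
      rw [Real.norm_eq_abs, Real.norm_eq_abs]
      linarith
    have h1 := intervalIntegral.norm_integral_le_of_norm_le_const hbound
    rw [Real.norm_eq_abs, abs_of_nonneg (sub_nonneg.2 hst)] at h1
    refine h1.trans (hsε.trans ?_)
    gcongr
    rw [abs_of_nonneg (by linarith)]
    linarith

/-- A function with an rd-continuous delta derivative is the integral of that derivative. -/
lemma eq_add_deltaIntegral (hT : IsClosed T) (hc : IsLeast T c) {f g : ℝ → ℝ}
    (hf : RdCont (RdDomain.ofSet T) f) (hg : ∀ t ∈ kappa T, HasDeltaDerivAt T g (f t) t) {x : ℝ}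
    (hx : x ∈ T) : g x = g c + deltaIntegral T f c x := by
  have h := eq_of_hasDeltaDerivAt_zero (f := fun x => g x + -deltaIntegral T f c x) hT hc.1 hx
    (hc.2 hx) fun t ht => by
      simpa using (hg t ht).add (hasDeltaDerivAt_deltaIntegral hT hc hf ht.1).neg
  simp only [deltaIntegral_self] at h
  linarith

/-- Integrals of rd-continuous functions are rd-continuous in the parameters and in the upper
limit. -/
lemma RdCont.deltaIntegral {g : X × ℝ → ℝ} (hg : RdCont (D.prod (RdDomain.ofSet T)) g)
    (hT : IsClosed T) (hc : IsLeast T c) :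
    RdCont (D.prod (RdDomain.ofSet T))
      (fun w => TimeScale.deltaIntegral T (fun τ => g (w.1, τ)) c w.2) := by
  rintro ⟨p₀, y₀⟩ ⟨hp₀, hy₀⟩ _ ⟨l, hl, m, hm, rfl⟩
  have hp₀' : p₀ ∈ D.carrier := hp₀
  have hy₀' : y₀ ∈ T := hy₀
  have := D.countable _ l hl
  have hslice : ∀ τ, ∃ L, τ ∈ T → Tendsto (fun p => g (p, τ)) l (𝓝 L) := by
    intro τ
    by_cases hτ : τ ∈ T
    · obtain ⟨v, hv, hpure⟩ := (RdDomain.ofSet T).exists_pure τ hτ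
      obtain ⟨L, hL⟩ := hg (p₀, τ) ⟨hp₀, hτ⟩ _ (mem_image2_of_mem hl hv)
      exact ⟨L, fun _ => hL.comp (tendsto_id.prodMk (tendsto_const_pure.mono_right hpure))⟩
    · exact ⟨0, fun h => absurd h hτ⟩
  choose L hL using hslice
  obtain ⟨C, hC⟩ := hg.eventually_bound hT hp₀' hl c (y₀ + 1)
  have hcar : ∀ᶠ p in l, p ∈ D.carrier := D.le_principal _ hp₀' l hl (mem_principal_self _)
  have hrd : ∀ p ∈ D.carrier, RdCont (RdDomain.ofSet T) fun τ => g (p, τ) := fun p hp =>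
    hg.comp (rdMap_slice hp)
  have h1 : Tendsto (fun p => ∫ r in c..y₀, g (p, lastPoint T c r)) l
      (𝓝 (∫ r in c..y₀, L (lastPoint T c r))) := by
    refine intervalIntegral.tendsto_integral_filter_of_dominated_convergence (fun _ => C) ?_ ?_
      (by simp) (Eventually.of_forall fun r _ => hL _ (lastPoint_mem hT hc.1 r))
    · filter_upwards [hcar] with p hp
      exact ((hrd p hp).measurable_lastPoint hT hc.1).aestronglyMeasurable
    · filter_upwards [hC] with p hp
      refine Eventually.of_forall fun r hr => ?_
      rw [uIoc_of_le (hc.2 hy₀')] at hr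
      exact hp _ ⟨lastPoint_mem hT hc.1 r, base_le_lastPoint hT hc.1 r,
        lastPoint_le hT hc.1 (by linarith [hr.2]) (by linarith [hc.2 hy₀'])⟩
  have hm' : m ≤ 𝓝[T] y₀ := RdDomain.approach_ofSet_le hy₀' hm
  have hy : Tendsto (fun y => C * |y - y₀|) m (𝓝 0) := by
    have : Tendsto (fun y => C * |y - y₀|) (𝓝 y₀) (𝓝 (C * |y₀ - y₀|)) := by
      apply Continuous.tendsto
      fun_prop
    rw [sub_self, abs_zero, mul_zero] at this
    exact this.mono_left (hm'.trans inf_le_left)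
  have h2 : Tendsto (fun w : X × ℝ => TimeScale.deltaIntegral T (fun τ => g (w.1, τ)) c w.2 -
      ∫ r in c..y₀, g (w.1, lastPoint T c r)) (l ×ˢ m) (𝓝 0) := by
    refine squeeze_zero_norm' ?_ (hy.comp tendsto_snd)
    have hlt : ∀ᶠ y in m, y < y₀ + 1 := hm'.trans inf_le_left (Iio_mem_nhds (by linarith))
    have hmem : ∀ᶠ y in m, y ∈ T := hm' self_mem_nhdsWithin
    filter_upwards [(hC.and hcar).prod_mk (hlt.and hmem)] with w hw
    obtain ⟨⟨hCw, hcw⟩, hwlt, hwT⟩ := hw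
    have hi := (hrd _ hcw).intervalIntegrable hT hc.1
    rw [deltaIntegral_eq _ (hc.2 hwT),
      intervalIntegral.integral_interval_sub_left (hi _ _) (hi _ _)]
    refine intervalIntegral.norm_integral_le_of_norm_le_const fun r hr => ?_
    refine hCw _ ⟨lastPoint_mem hT hc.1 r, base_le_lastPoint hT hc.1 r,
      lastPoint_le hT hc.1 ?_ (by linarith [hc.2 hy₀'])⟩
    exact (uIoc_subset_uIcc hr).2.trans (max_le (by linarith) (le_of_lt hwlt))
  refine ⟨_, (h2.add (h1.comp tendsto_fst)).congr fun w => ?_⟩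
  exact sub_add_cancel _ _

/-- Fubini's theorem for rd-continuous functions. -/
lemma deltaIntegral_swap (hT : IsClosed T) (hT' : IsClosed T') (hc : IsLeast T c)
    (hc' : IsLeast T' c') {f : ℝ × ℝ → ℝ}
    (hf : RdCont ((RdDomain.ofSet T).prod (RdDomain.ofSet T')) f) {x y : ℝ} (hx : x ∈ T)
    (hy : y ∈ T') :
    deltaIntegral T (fun s => deltaIntegral T' (fun t => f (s, t)) c' y) c x =
      deltaIntegral T' (fun t => deltaIntegral T (fun s => f (s, t)) c x) c' y := by
  have hcx := hc.2 hx
  have hcy := hc'.2 hy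
  simp only [deltaIntegral_eq _ hcx, deltaIntegral_eq _ hcy]
  refine intervalIntegral_intervalIntegral_swap
    (F := fun r r' => f (lastPoint T c r, lastPoint T' c' r')) ?_
  have hmeas : Measurable fun w : ℝ × ℝ => f (lastPoint T c w.1, lastPoint T' c' w.2) := by
    refine measurable_of_tendsto_nhdsGE_prod fun w => ?_
    have h1 := lastPoint_mem hT hc.1 w.1
    have h2 := lastPoint_mem hT' hc'.1 w.2
    have hlim : Tendsto f (valueApproach T (lastPoint T c w.1) ×ˢ
        valueApproach T' (lastPoint T' c' w.2))
        (𝓝 (f (lastPoint T c w.1, lastPoint T' c' w.2))) := by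
      refine hf.tendsto_value (t := (lastPoint T c w.1, lastPoint T' c' w.2)) ⟨h1, h2⟩
        (mem_image2_of_mem (Or.inr rfl) (Or.inr rfl)) ?_
      rw [show (pure (lastPoint T c w.1, lastPoint T' c' w.2) : Filter (ℝ × ℝ)) =
        (pure (lastPoint T c w.1) : Filter ℝ) ×ˢ (pure (lastPoint T' c' w.2) : Filter ℝ) by simp]
      exact Filter.prod_mono (pure_le_valueApproach h1) (pure_le_valueApproach h2)
    exact hlim.comp (((tendsto_lastPoint hT hc.1 w.1).comp tendsto_fst).prodMk
      ((tendsto_lastPoint hT' hc'.1 w.2).comp tendsto_snd))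
  rw [IntegrableOn, Measure.volume_eq_prod, ← Measure.prod_restrict, uIoc_of_le hcx, uIoc_of_le hcy]
  refine (integrable_prod_iff hmeas.aestronglyMeasurable).2 ⟨?_, ?_⟩
  · refine Eventually.of_forall fun r => ?_
    have h := ((hf.comp (rdMap_slice (lastPoint_mem hT hc.1 r))).intervalIntegrable hT' hc'.1 c' y)
    exact (intervalIntegrable_iff_integrableOn_Ioc_of_le hcy).1 h
  · have h := ((hf.abs.deltaIntegral hT' hc').comp
      (rdMap_id.prodMk (rdMap_const hy))).intervalIntegrable hT hc.1 c x
    have h' := (intervalIntegrable_iff_integrableOn_Ioc_of_le hcx).1 h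
    refine h'.congr (Eventually.of_forall fun r => ?_)
    simp only [deltaIntegral_eq _ hcy, intervalIntegral.integral_of_le hcy]
    rfl

end

/-! ### The exponential weight -/

lemma measurable_cylinder (w : ℝ) : Measurable fun h => cylinder h w := by
  unfold cylinder
  refine Measurable.ite (measurableSet_singleton 0) measurable_const ?_
  exact (Real.measurable_log.comp (by fun_prop)).div measurable_id

lemma abs_cylinder_le {h w : ℝ} (hh : 0 ≤ h) (hw : 0 ≤ w) : |cylinder h w| ≤ w := by
  unfold cylinder
  split_ifs with h0
  · rw [abs_of_nonneg hw]
  · have hpos : 0 < h := lt_of_le_of_ne hh (Ne.symm h0)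
    have h1 : 1 ≤ 1 + h * w := le_add_of_nonneg_right (mul_nonneg hh hw)
    rw [abs_of_nonneg (div_nonneg (Real.log_nonneg h1) hh), div_le_iff₀ hpos]
    have := Real.log_le_sub_one_of_pos (show 0 < 1 + h * w by linarith)
    linarith

lemma continuousOn_tsExp {T : Set ℝ} (hT : IsClosed T) {c lam : ℝ} (hc : c ∈ T) (hlam : 0 ≤ lam) :
    ContinuousOn (fun x => tsExp T (fun _ => lam) x c) (Ici c) := by
  set h : ℝ → ℝ := fun r => cylinder (graininess T (lastPoint T c r)) lam with hh
  have hmeas : Measurable h := by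
    refine (measurable_cylinder lam).comp (Measurable.sub ?_ (lastPoint_mono hT hc).measurable)
    exact ((sigma_mono T).comp (lastPoint_mono hT hc)).measurable
  have hi : ∀ x y, IntervalIntegrable h volume x y := fun x y => by
    rw [intervalIntegrable_iff]
    exact Measure.integrableOn_of_bounded (M := lam) (by simp [uIoc]) hmeas.aestronglyMeasurable
      (Eventually.of_forall fun r =>
        abs_cylinder_le (sub_nonneg.2 (le_sigma T (lastPoint T c r))) hlam)
  refine (Real.continuous_exp.comp
    (intervalIntegral.continuous_primitive hi c)).continuousOn.congr fun x hx => ?_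
  rw [tsExp, deltaIntegral_eq _ hx]
  rfl

lemma expWeight_pos (T₁ T₂ T₃ : Set ℝ) (x₀ y₀ lam x y z : ℝ) :
    0 < expWeight T₁ T₂ T₃ x₀ y₀ lam x y z :=
  mul_pos (mul_pos (Real.exp_pos _) (Real.exp_pos _)) (Real.exp_pos _)

lemma rdCont_expWeight {T₁ T₂ T₃ I : Set ℝ} (hT₁ : IsClosed T₁) (hT₂ : IsClosed T₂)
    (hT₃ : IsClosed T₃) {x₀ y₀ lam : ℝ} (hx₀ : IsLeast T₁ x₀) (hy₀ : IsLeast T₂ y₀)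
    (h0 : (0 : ℝ) ∈ T₃) (hlam : 0 ≤ lam) :
    RdCont (RdDomain.triple T₁ T₂ I)
      (fun p => expWeight T₁ T₂ T₃ x₀ y₀ lam p.1 p.2.1 p.2.2) := by
  have h1 : ContinuousOn (fun x => tsExp T₁ (fun _ => lam) x x₀) T₁ :=
    (continuousOn_tsExp hT₁ hx₀.1 hlam).mono fun x hx => hx₀.2 hx
  have h2 : ContinuousOn (fun y => tsExp T₂ (fun _ => lam) y y₀) T₂ :=
    (continuousOn_tsExp hT₂ hy₀.1 hlam).mono fun y hy => hy₀.2 hy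
  have h3 : ContinuousOn (fun z => tsExp T₃ (fun _ => lam) |z| 0) I :=
    (continuousOn_tsExp hT₃ h0 hlam).comp continuous_abs.continuousOn fun z _ => abs_nonneg z
  exact ((h1.rdCont.comp rdMap_id.fst).mul (h2.rdCont.comp rdMap_id.snd.fst)).mul
    (h3.rdCont.comp rdMap_id.snd.snd)

/-! ### Contractions with respect to a weight -/

section Contraction

variable {X E : Type*} [MetricSpace E] {s : Set X} {e : X → ℝ} {P : (X → E) → Prop}
  {A : (X → E) → X → E} {γ : ℝ}

/-- Banach's fixed point theorem for the distance `sup_{x ∈ s} dist (w x) (w' x) / e x` on the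
functions with the property `P`. The distance need not be finite: it is enough that `w₀` has a
finite distance from its image. -/
lemma exists_fixedPoint_of_weight [CompleteSpace E] (hγ0 : 0 ≤ γ) (hγ : γ < 1)
    (hA : ∀ w, P w → P (A w))
    (hlip : ∀ w w', P w → P w' → ∀ k, (∀ x ∈ s, dist (w x) (w' x) ≤ k * e x) →
      ∀ x ∈ s, dist (A w x) (A w' x) ≤ γ * k * e x)
    (hP : ∀ (w : ℕ → X → E) (w' : X → E) (r : ℕ → ℝ), (∀ n, P (w n)) → Tendsto r atTop (𝓝 0) →
      (∀ n, ∀ x ∈ s, dist (w n x) (w' x) ≤ r n * e x) → P w')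
    {w₀ : X → E} (h₀ : P w₀) {k : ℝ} (hk : ∀ x ∈ s, dist (w₀ x) (A w₀ x) ≤ k * e x) :
    ∃ w, P w ∧ (∀ x ∈ s, A w x = w x) ∧ ∀ x ∈ s, dist (w₀ x) (w x) ≤ k / (1 - γ) * e x := by
  set W : ℕ → X → E := fun n => A^[n] w₀ with hW
  have hsucc : ∀ n, W (n + 1) = A (W n) := fun n => Function.iterate_succ_apply' A n w₀
  have hWP : ∀ n, P (W n) := fun n => by
    induction n with
    | zero => exact h₀
    | succ n ih => rw [hsucc]; exact hA _ ih
  have hgeo : ∀ n, ∀ x ∈ s, dist (W n x) (W (n + 1) x) ≤ (k * γ ^ n) * e x := fun n => by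
    induction n with
    | zero => simpa [hW] using hk
    | succ n ih =>
      intro x hx
      calc dist (W (n + 1) x) (W (n + 1 + 1) x) = dist (A (W n) x) (A (W (n + 1)) x) := by
            rw [hsucc (n + 1), ← hsucc n]
        _ ≤ γ * (k * γ ^ n) * e x := hlip _ _ (hWP n) (hWP (n + 1)) _ ih x hx
        _ = _ := by ring
  have hgeo' : ∀ x ∈ s, ∀ n, dist (W n x) (W (n + 1) x) ≤ (k * e x) * γ ^ n := fun x hx n =>
    (hgeo n x hx).trans (le_of_eq (by ring))
  have hex : ∀ x, ∃ a, x ∈ s → Tendsto (fun n => W n x) atTop (𝓝 a) := fun x => by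
    by_cases hx : x ∈ s
    · obtain ⟨a, ha⟩ := cauchySeq_tendsto_of_complete
        (cauchySeq_of_le_geometric γ (k * e x) hγ (hgeo' x hx))
      exact ⟨a, fun _ => ha⟩
    · exact ⟨w₀ x, fun h => absurd h hx⟩
  choose w hw using hex
  have hdist : ∀ n, ∀ x ∈ s, dist (W n x) (w x) ≤ (k / (1 - γ) * γ ^ n) * e x := fun n x hx =>
    (dist_le_of_le_geometric_of_tendsto γ (k * e x) hγ (hgeo' x hx) (hw x hx) n).trans
      (le_of_eq (by ring))
  have hr : Tendsto (fun n : ℕ => k / (1 - γ) * γ ^ n) atTop (𝓝 0) := by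
    simpa using (tendsto_pow_atTop_nhds_zero_of_lt_one hγ0 hγ).const_mul (k / (1 - γ))
  have hPw : P w := hP W w _ hWP hr hdist
  refine ⟨w, hPw, fun x hx => ?_, fun x hx => by simpa [hW] using hdist 0 x hx⟩
  have h1 : Tendsto (fun n => W (n + 1) x) atTop (𝓝 (w x)) :=
    (hw x hx).comp (tendsto_add_atTop_nat 1)
  have h2 : Tendsto (fun n => W (n + 1) x) atTop (𝓝 (A w x)) := by
    have hlim : Tendsto (fun n : ℕ => γ * (k / (1 - γ) * γ ^ n) * e x) atTop (𝓝 0) := by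
      simpa using (hr.const_mul γ).mul_const (e x)
    refine tendsto_iff_dist_tendsto_zero.2 (squeeze_zero (fun _ => dist_nonneg) (fun n => ?_) hlim)
    rw [hsucc]
    exact hlip _ _ (hWP n) hPw _ (hdist n) x hx
  exact tendsto_nhds_unique h2 h1

lemma eqOn_of_fixedPoint_of_weight (hγ0 : 0 ≤ γ) (hγ : γ < 1)
    (hlip : ∀ w w', P w → P w' → ∀ k, (∀ x ∈ s, dist (w x) (w' x) ≤ k * e x) →
      ∀ x ∈ s, dist (A w x) (A w' x) ≤ γ * k * e x)
    {w w' : X → E} (hw : P w) (hw' : P w') (h : ∀ x ∈ s, A w x = w x) (h' : ∀ x ∈ s, A w' x = w' x)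
    {k : ℝ} (hk : ∀ x ∈ s, dist (w x) (w' x) ≤ k * e x) : EqOn w w' s := by
  have hn : ∀ n : ℕ, ∀ x ∈ s, dist (w x) (w' x) ≤ (k * γ ^ n) * e x := fun n => by
    induction n with
    | zero => simpa using hk
    | succ n ih =>
      intro x hx
      have := hlip w w' hw hw' _ ih x hx
      rw [h x hx, h' x hx] at this
      exact this.trans (le_of_eq (by ring))
  intro x hx
  have hlim : Tendsto (fun n : ℕ => (k * γ ^ n) * e x) atTop (𝓝 0) := by
    simpa using ((tendsto_pow_atTop_nhds_zero_of_lt_one hγ0 hγ).const_mul k).mul_const (e x)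
  exact dist_le_zero.1 (ge_of_tendsto' hlim fun n => hn n x hx)

end Contraction

/-! ### The Goursat problem with a given right-hand side -/

/-- Values of a function together with its two partial delta derivatives. The distance is the sum
of the distances of the three components, as in `absW`. -/
abbrev Jet : Type := PiLp 1 fun _ : Fin 3 => ℝ

lemma Jet.dist_eq (p q : Jet) : dist p q = |p 0 - q 0| + |p 1 - q 1| + |p 2 - q 2| := by
  simp [PiLp.dist_eq_of_L1, Fin.sum_univ_three, Real.dist_eq]

/-- A function together with its two partial delta derivatives. -/
noncomputable def jet (T₁ T₂ : Set ℝ) (u : ℝ → ℝ → ℝ → ℝ) (p : ℝ × ℝ × ℝ) : Jet :=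
  WithLp.toLp 1 ![u p.1 p.2.1 p.2.2, pderiv₁ T₁ u p.1 p.2.1 p.2.2, pderiv₂ T₂ u p.1 p.2.1 p.2.2]

/-- The assumptions on the two time scales of the differential equation, on the set `I` of
parameters `z`, and on the boundary values. -/
structure GoursatData (T₁ T₂ I : Set ℝ) (x₀ y₀ : ℝ) (α β : ℝ → ℝ → ℝ) : Prop where
  closed₁ : IsClosed T₁
  closed₂ : IsClosed T₂
  nontrivial₁ : T₁.Nontrivial
  nontrivial₂ : T₂.Nontrivial
  least₁ : IsLeast T₁ x₀
  least₂ : IsLeast T₂ y₀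
  rd_α : RdCont ((RdDomain.ofSet T₁).prod (RdDomain.ofSet I)) fun w => α w.1 w.2
  rd_β : RdCont ((RdDomain.ofSet T₂).prod (RdDomain.ofSet I)) fun w => β w.1 w.2
  rd_deriv_α : RdCont ((RdDomain.ofSet T₁).prod (RdDomain.ofSet I))
    fun w => deltaDeriv T₁ (fun s => α s w.2) w.1
  rd_deriv_β : RdCont ((RdDomain.ofSet T₂).prod (RdDomain.ofSet I))
    fun w => deltaDeriv T₂ (fun t => β t w.2) w.1
  diff_α : ∀ z ∈ I, DeltaDifferentiable T₁ fun s => α s z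
  diff_β : ∀ z ∈ I, DeltaDifferentiable T₂ fun t => β t z
  compat : ∀ z ∈ I, α x₀ z = β y₀ z

/-- The solution `u` of `u^{Δ₂Δ₁} = f` with boundary values `α` and `β`, and its two partial
derivatives. The derivatives are `0` at a left-scattered maximum, by the convention in
`deltaDeriv`. -/
noncomputable def goursat (T₁ T₂ : Set ℝ) (x₀ y₀ : ℝ) (α β : ℝ → ℝ → ℝ) (f : ℝ × ℝ × ℝ → ℝ)
    (p : ℝ × ℝ × ℝ) : Jet :=
  WithLp.toLp 1 ![
    α p.1 p.2.2 + β p.2.1 p.2.2 - α x₀ p.2.2 +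
      deltaIntegral T₁ (fun s => deltaIntegral T₂ (fun t => f (s, t, p.2.2)) y₀ p.2.1) x₀ p.1,
    (kappa T₁).indicator (fun _ => 1) p.1 * (deltaDeriv T₁ (fun s => α s p.2.2) p.1 +
      deltaIntegral T₂ (fun t => f (p.1, t, p.2.2)) y₀ p.2.1),
    (kappa T₂).indicator (fun _ => 1) p.2.1 * (deltaDeriv T₂ (fun t => β t p.2.2) p.2.1 +
      deltaIntegral T₁ (fun s => f (s, p.2.1, p.2.2)) x₀ p.1)]

section Goursat

variable {T₁ T₂ I : Set ℝ} {x₀ y₀ : ℝ} {α β : ℝ → ℝ → ℝ} {f f' g : ℝ × ℝ × ℝ → ℝ}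

lemma RdCont.deltaIntegral₁ (hT₁ : IsClosed T₁) (hx₀ : IsLeast T₁ x₀)
    (hf : RdCont (RdDomain.triple T₁ T₂ I) f) :
    RdCont (RdDomain.triple T₁ T₂ I)
      fun p => TimeScale.deltaIntegral T₁ (fun s => f (s, p.2.1, p.2.2)) x₀ p.1 := by
  have h : RdCont (((RdDomain.ofSet T₂).prod (RdDomain.ofSet I)).prod (RdDomain.ofSet T₁))
      (fun w => f (w.2, w.1.1, w.1.2)) :=
    hf.comp (rdMap_id.snd.prodMk (rdMap_id.fst.fst.prodMk rdMap_id.fst.snd))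
  exact (h.deltaIntegral hT₁ hx₀).comp (D := RdDomain.triple T₁ T₂ I)
    ((rdMap_id.snd.fst.prodMk rdMap_id.snd.snd).prodMk rdMap_id.fst)

lemma RdCont.deltaIntegral₂ (hT₂ : IsClosed T₂) (hy₀ : IsLeast T₂ y₀)
    (hf : RdCont (RdDomain.triple T₁ T₂ I) f) :
    RdCont (RdDomain.triple T₁ T₂ I)
      fun p => TimeScale.deltaIntegral T₂ (fun t => f (p.1, t, p.2.2)) y₀ p.2.1 := by
  have h : RdCont (((RdDomain.ofSet T₁).prod (RdDomain.ofSet I)).prod (RdDomain.ofSet T₂))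
      (fun w => f (w.1.1, w.2, w.1.2)) :=
    hf.comp (rdMap_id.fst.fst.prodMk (rdMap_id.snd.prodMk rdMap_id.fst.snd))
  exact (h.deltaIntegral hT₂ hy₀).comp (D := RdDomain.triple T₁ T₂ I)
    ((rdMap_id.fst.prodMk rdMap_id.snd.snd).prodMk rdMap_id.snd.fst)

lemma RdCont.slice₁ (hf : RdCont (RdDomain.triple T₁ T₂ I) f) {y z : ℝ} (hy : y ∈ T₂)
    (hz : z ∈ I) : RdCont (RdDomain.ofSet T₁) fun s => f (s, y, z) :=
  hf.comp (rdMap_id.prodMk ((rdMap_const hy).prodMk (rdMap_const hz)))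

lemma RdCont.slice₂ (hf : RdCont (RdDomain.triple T₁ T₂ I) f) {x z : ℝ} (hx : x ∈ T₁)
    (hz : z ∈ I) : RdCont (RdDomain.ofSet T₂) fun t => f (x, t, z) :=
  hf.comp ((rdMap_const hx).prodMk (rdMap_id.prodMk (rdMap_const hz)))

namespace GoursatData

lemma rdCont_goursat (h : GoursatData T₁ T₂ I x₀ y₀ α β)
    (hf : RdCont (RdDomain.triple T₁ T₂ I) f) (i : Fin 3) :
    RdCont (RdDomain.triple T₁ T₂ I) fun p => goursat T₁ T₂ x₀ y₀ α β f p i := by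
  have hxz : RdMap (RdDomain.triple T₁ T₂ I) ((RdDomain.ofSet T₁).prod (RdDomain.ofSet I))
      fun p => (p.1, p.2.2) := rdMap_id.fst.prodMk rdMap_id.snd.snd
  have hyz : RdMap (RdDomain.triple T₁ T₂ I) ((RdDomain.ofSet T₂).prod (RdDomain.ofSet I))
      fun p => (p.2.1, p.2.2) := rdMap_id.snd.fst.prodMk rdMap_id.snd.snd
  have hx₀z : RdMap (RdDomain.triple T₁ T₂ I) ((RdDomain.ofSet T₁).prod (RdDomain.ofSet I))
      fun p => (x₀, p.2.2) := (rdMap_const h.least₁.1).prodMk rdMap_id.snd.snd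
  have h1 := hf.deltaIntegral₁ h.closed₁ h.least₁
  have h2 := hf.deltaIntegral₂ h.closed₂ h.least₂
  fin_cases i
  · exact (((h.rd_α.comp hxz).add (h.rd_β.comp hyz)).sub (h.rd_α.comp hx₀z)).add
      (h2.deltaIntegral₁ h.closed₁ h.least₁)
  · exact ((rdCont_indicator_kappa T₁).comp rdMap_id.fst).mul ((h.rd_deriv_α.comp hxz).add h2)
  · exact ((rdCont_indicator_kappa T₂).comp rdMap_id.snd.fst).mul ((h.rd_deriv_β.comp hyz).add h1)

lemma hasDeltaDerivAt_goursat₁ (h : GoursatData T₁ T₂ I x₀ y₀ α β)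
    (hf : RdCont (RdDomain.triple T₁ T₂ I) f) {x y z : ℝ}
    (hx : x ∈ kappa T₁) (hy : y ∈ T₂) (hz : z ∈ I) :
    HasDeltaDerivAt T₁ (fun s => goursat T₁ T₂ x₀ y₀ α β f (s, y, z) 0)
      (goursat T₁ T₂ x₀ y₀ α β f (x, y, z) 1) x := by
  have h1 := hasDeltaDerivAt_deltaIntegral h.closed₁ h.least₁
    ((hf.deltaIntegral₂ h.closed₂ h.least₂).slice₁ hy hz) hx.1
  have h2 := ((h.diff_α z hz).hasDeltaDerivAt hx).add
    ((hasDeltaDerivAt_const T₁ (β y z - α x₀ z) x).add h1)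
  have hval : goursat T₁ T₂ x₀ y₀ α β f (x, y, z) 1 = deltaDeriv T₁ (fun s => α s z) x +
      (0 + deltaIntegral T₂ (fun t => f (x, t, z)) y₀ y) := by
    simp [goursat, hx]
  rw [hval]
  refine h2.congr h.closed₁ hx.1 fun s _ => ?_
  simp only [goursat, PiLp.toLp_apply, Matrix.cons_val_zero]
  ring

/-- In the second variable the outer integral is differentiated after exchanging the order of
integration. -/
lemma hasDeltaDerivAt_goursat₂ (h : GoursatData T₁ T₂ I x₀ y₀ α β)
    (hf : RdCont (RdDomain.triple T₁ T₂ I) f) {x y z : ℝ}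
    (hx : x ∈ T₁) (hy : y ∈ kappa T₂) (hz : z ∈ I) :
    HasDeltaDerivAt T₂ (fun t => goursat T₁ T₂ x₀ y₀ α β f (x, t, z) 0)
      (goursat T₁ T₂ x₀ y₀ α β f (x, y, z) 2) y := by
  have h1 := hasDeltaDerivAt_deltaIntegral h.closed₂ h.least₂
    ((hf.deltaIntegral₁ h.closed₁ h.least₁).slice₂ hx hz) hy.1
  have h2 := ((h.diff_β z hz).hasDeltaDerivAt hy).add
    ((hasDeltaDerivAt_const T₂ (α x z - α x₀ z) y).add h1)
  have hval : goursat T₁ T₂ x₀ y₀ α β f (x, y, z) 2 = deltaDeriv T₂ (fun t => β t z) y +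
      (0 + deltaIntegral T₁ (fun s => f (s, y, z)) x₀ x) := by
    simp [goursat, hy]
  rw [hval]
  refine h2.congr h.closed₂ hy.1 fun t ht => ?_
  have hswap := deltaIntegral_swap h.closed₁ h.closed₂ h.least₁ h.least₂
    (f := fun w => f (w.1, w.2, z))
    (hf.comp (rdMap_id.fst.prodMk (rdMap_id.snd.prodMk (rdMap_const hz)))) hx ht
  simp only [goursat, PiLp.toLp_apply, Matrix.cons_val_zero]
  rw [hswap]
  ring

lemma hasDeltaDerivAt_goursat₂₁ (h : GoursatData T₁ T₂ I x₀ y₀ α β)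
    (hf : RdCont (RdDomain.triple T₁ T₂ I) f) {x y z : ℝ}
    (hx : x ∈ T₁) (hy : y ∈ kappa T₂) (hz : z ∈ I) :
    HasDeltaDerivAt T₁ (fun s => goursat T₁ T₂ x₀ y₀ α β f (s, y, z) 2) (f (x, y, z)) x := by
  have h1 := (hasDeltaDerivAt_const T₁ (deltaDeriv T₂ (fun t => β t z) y) x).add
    (hasDeltaDerivAt_deltaIntegral h.closed₁ h.least₁ (hf.slice₁ hy.1 hz) hx)
  rw [zero_add] at h1
  exact h1.congr h.closed₁ hx fun s _ => by simp [goursat, hy]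

/-- The three components of `goursat` are a function and its derivatives. -/
lemma jet_eq_goursat (h : GoursatData T₁ T₂ I x₀ y₀ α β)
    (hf : RdCont (RdDomain.triple T₁ T₂ I) f) {u : ℝ → ℝ → ℝ → ℝ}
    (hu : ∀ x ∈ T₁, ∀ y ∈ T₂, ∀ z ∈ I, u x y z = goursat T₁ T₂ x₀ y₀ α β f (x, y, z) 0) :
    EqOn (jet T₁ T₂ u) (goursat T₁ T₂ x₀ y₀ α β f) (RdDomain.triple T₁ T₂ I).carrier := by
  rintro ⟨x, y, z⟩ ⟨hx, hy, hz⟩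
  have h1 : pderiv₁ T₁ u x y z = goursat T₁ T₂ x₀ y₀ α β f (x, y, z) 1 := by
    by_cases hk : x ∈ kappa T₁
    · exact ((h.hasDeltaDerivAt_goursat₁ hf hk hy hz).congr h.closed₁ hx
        fun s hs => hu s hs y hy z hz).deltaDeriv_eq h.nontrivial₁ hk
    · rw [pderiv₁, deltaDeriv_of_notMem hk]
      simp [goursat, hk]
  have h2 : pderiv₂ T₂ u x y z = goursat T₁ T₂ x₀ y₀ α β f (x, y, z) 2 := by
    by_cases hk : y ∈ kappa T₂
    · exact ((h.hasDeltaDerivAt_goursat₂ hf hx hk hz).congr h.closed₂ hy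
        fun t ht => hu x hx t ht z hz).deltaDeriv_eq h.nontrivial₂ hk
    · rw [pderiv₂, deltaDeriv_of_notMem hk]
      simp [goursat, hk]
  ext i
  fin_cases i
  · exact hu x hx y hy z hz
  · exact h1
  · exact h2

/-- The Goursat problem with a given right-hand side has no other solution than `goursat`. -/
lemma eq_goursat (h : GoursatData T₁ T₂ I x₀ y₀ α β)
    (hf : RdCont (RdDomain.triple T₁ T₂ I) f) {u : ℝ → ℝ → ℝ → ℝ}
    (hdiff : ∀ x ∈ T₁, ∀ z ∈ I, DeltaDifferentiable T₂ fun t => u x t z)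
    (hrd : RdCont (RdDomain.triple T₁ T₂ I) fun p => pderiv₂ T₂ u p.1 p.2.1 p.2.2)
    (heqn : ∀ x ∈ kappa T₁, ∀ y ∈ kappa T₂, ∀ z ∈ I,
      HasDeltaDerivAt T₁ (fun s => pderiv₂ T₂ u s y z) (f (x, y, z)) x)
    (hα : ∀ x ∈ T₁, ∀ z ∈ I, u x y₀ z = α x z) (hβ : ∀ y ∈ T₂, ∀ z ∈ I, u x₀ y z = β y z) :
    ∀ x ∈ T₁, ∀ y ∈ T₂, ∀ z ∈ I, u x y z = goursat T₁ T₂ x₀ y₀ α β f (x, y, z) 0 := by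
  intro x hx y hy z hz
  have h2 : ∀ t ∈ kappa T₂, pderiv₂ T₂ u x t z = deltaDeriv T₂ (fun t => β t z) t +
      deltaIntegral T₁ (fun s => f (s, t, z)) x₀ x := by
    intro t ht
    rw [eq_add_deltaIntegral h.closed₁ h.least₁ (hf.slice₁ ht.1 hz)
      (fun s hs => heqn s hs t ht z hz) hx]
    congr 1
    exact ((((h.diff_β z hz).hasDeltaDerivAt ht).congr h.closed₂ ht.1
      fun s hs => hβ s hs z hz)).deltaDeriv_eq h.nontrivial₂ ht
  have hrdβ : RdCont (RdDomain.ofSet T₂) fun t => deltaDeriv T₂ (fun t => β t z) t :=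
    h.rd_deriv_β.comp (rdMap_id.prodMk (rdMap_const hz))
  have hint : deltaIntegral T₂ (fun t => pderiv₂ T₂ u x t z) y₀ y =
      deltaIntegral T₂ (fun t => deltaDeriv T₂ (fun t => β t z) t +
        deltaIntegral T₁ (fun s => f (s, t, z)) x₀ x) y₀ y :=
    deltaIntegral_congr h.closed₂ h.least₂.1 (h.least₂.2 hy)
      fun t ht _ hty => h2 t (mem_kappa_of_lt ht hy hty)
  have h3 := eq_add_deltaIntegral h.closed₂ h.least₂ (hrd.slice₂ hx hz)
    (fun t ht => (hdiff x hx z hz).hasDeltaDerivAt ht) hy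
  have h4 := eq_add_deltaIntegral h.closed₂ h.least₂ hrdβ
    (fun t ht => (h.diff_β z hz).hasDeltaDerivAt ht) hy
  have hswap := deltaIntegral_swap h.closed₁ h.closed₂ h.least₁ h.least₂
    (f := fun w => f (w.1, w.2, z))
    (hf.comp (rdMap_id.fst.prodMk (rdMap_id.snd.prodMk (rdMap_const hz)))) hx hy
  simp only [goursat, PiLp.toLp_apply, Matrix.cons_val_zero]
  rw [hswap, h3, hα x hx z hz]
  change α x z + deltaIntegral T₂ (fun t => pderiv₂ T₂ u x t z) y₀ y = _
  rw [hint, deltaIntegral_add h.closed₂ h.least₂.1 (h.least₂.2 hy) hrdβ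
    ((hf.deltaIntegral₁ h.closed₁ h.least₁).slice₂ hx hz), h4, h.compat z hz]
  ring

end GoursatData

lemma abs_deltaIntegral_sub_le {T : Set ℝ} {c : ℝ} (hT : IsClosed T) (hc : c ∈ T)
    {f f' g : ℝ → ℝ} {x : ℝ} (hcx : c ≤ x) (hf : RdCont (RdDomain.ofSet T) f)
    (hf' : RdCont (RdDomain.ofSet T) f') (hg : RdCont (RdDomain.ofSet T) g)
    (h : ∀ t ∈ T, |f t - f' t| ≤ g t) :
    |deltaIntegral T f c x - deltaIntegral T f' c x| ≤ deltaIntegral T g c x := by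
  rw [← deltaIntegral_sub hT hc hcx hf hf']
  exact abs_deltaIntegral_le hT hc hcx hg fun t ht _ _ => h t ht

lemma abs_indicator_mul_le (s : Set ℝ) (x a : ℝ) : |s.indicator (fun _ => 1) x * a| ≤ |a| := by
  by_cases hx : x ∈ s <;> simp [hx]

lemma GoursatData.dist_goursat_le (h : GoursatData T₁ T₂ I x₀ y₀ α β)
    (hf : RdCont (RdDomain.triple T₁ T₂ I) f) (hf' : RdCont (RdDomain.triple T₁ T₂ I) f')
    (hg : RdCont (RdDomain.triple T₁ T₂ I) g)
    (hfg : ∀ p ∈ (RdDomain.triple T₁ T₂ I).carrier, |f p - f' p| ≤ g p)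
    {x y z : ℝ} (hx : x ∈ T₁) (hy : y ∈ T₂) (hz : z ∈ I) :
    dist (goursat T₁ T₂ x₀ y₀ α β f (x, y, z)) (goursat T₁ T₂ x₀ y₀ α β f' (x, y, z)) ≤
      deltaIntegral T₁ (fun s => deltaIntegral T₂ (fun t => g (s, t, z)) y₀ y) x₀ x +
      deltaIntegral T₂ (fun t => g (x, t, z)) y₀ y +
      deltaIntegral T₁ (fun s => g (s, y, z)) x₀ x := by
  have h2 : ∀ s ∈ T₁, |deltaIntegral T₂ (fun t => f (s, t, z)) y₀ y -
      deltaIntegral T₂ (fun t => f' (s, t, z)) y₀ y| ≤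
      deltaIntegral T₂ (fun t => g (s, t, z)) y₀ y := fun s hs =>
    abs_deltaIntegral_sub_le h.closed₂ h.least₂.1 (h.least₂.2 hy) (hf.slice₂ hs hz)
      (hf'.slice₂ hs hz) (hg.slice₂ hs hz) fun t ht => hfg _ ⟨hs, ht, hz⟩
  have h1 := abs_deltaIntegral_sub_le h.closed₁ h.least₁.1 (h.least₁.2 hx) (hf.slice₁ hy hz)
      (hf'.slice₁ hy hz) (hg.slice₁ hy hz) fun s hs => hfg _ ⟨hs, hy, hz⟩
  have h12 := abs_deltaIntegral_sub_le h.closed₁ h.least₁.1 (h.least₁.2 hx)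
    ((hf.deltaIntegral₂ h.closed₂ h.least₂).slice₁ hy hz)
    ((hf'.deltaIntegral₂ h.closed₂ h.least₂).slice₁ hy hz)
    ((hg.deltaIntegral₂ h.closed₂ h.least₂).slice₁ hy hz) h2
  rw [Jet.dist_eq]
  refine add_le_add (add_le_add ?_ ?_) ?_
  · simpa [goursat] using h12
  · refine le_trans (le_of_eq_of_le ?_ (abs_indicator_mul_le (kappa T₁) x _)) (h2 x hx)
    simp only [goursat, PiLp.toLp_apply, Matrix.cons_val_one, Matrix.cons_val_zero]
    congr 1
    ring
  · refine le_trans (le_of_eq_of_le ?_ (abs_indicator_mul_le (kappa T₂) y _)) h1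
    simp only [goursat, PiLp.toLp_apply, Matrix.cons_val]
    congr 1
    ring

/-- The size of `goursat` in terms of the boundary values and integrals of `|f|`. -/
lemma GoursatData.dist_zero_goursat_le (h : GoursatData T₁ T₂ I x₀ y₀ α β)
    (hf : RdCont (RdDomain.triple T₁ T₂ I) f) {x y z : ℝ} (hx : x ∈ T₁) (hy : y ∈ T₂) (hz : z ∈ I)
    {k₁ k₂ k₃ : ℝ}
    (h₁ : |α x z| + |β y z| + |α x₀ z| + deltaIntegral T₁ (fun s =>
      deltaIntegral T₂ (fun t => |f (s, t, z)|) y₀ y) x₀ x ≤ k₁)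
    (hk₂ : 0 ≤ k₂) (hk₃ : 0 ≤ k₃)
    (h₂ : x ∈ kappa T₁ → |deltaDeriv T₁ (fun s => α s z) x| +
      deltaIntegral T₂ (fun t => |f (x, t, z)|) y₀ y ≤ k₂)
    (h₃ : y ∈ kappa T₂ → |deltaDeriv T₂ (fun t => β t z) y| +
      deltaIntegral T₁ (fun s => |f (s, y, z)|) x₀ x ≤ k₃) :
    dist 0 (goursat T₁ T₂ x₀ y₀ α β f (x, y, z)) ≤ k₁ + k₂ + k₃ := by
  have i2 : ∀ s ∈ T₁, |deltaIntegral T₂ (fun t => f (s, t, z)) y₀ y| ≤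
      deltaIntegral T₂ (fun t => |f (s, t, z)|) y₀ y := fun s hs =>
    abs_deltaIntegral_le h.closed₂ h.least₂.1 (h.least₂.2 hy) (hf.slice₂ hs hz).abs
      fun _ _ _ _ => le_rfl
  have i1 : |deltaIntegral T₁ (fun s => f (s, y, z)) x₀ x| ≤
      deltaIntegral T₁ (fun s => |f (s, y, z)|) x₀ x :=
    abs_deltaIntegral_le h.closed₁ h.least₁.1 (h.least₁.2 hx) (hf.slice₁ hy hz).abs
      fun _ _ _ _ => le_rfl
  have i12 := abs_deltaIntegral_le h.closed₁ h.least₁.1 (h.least₁.2 hx)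
    ((hf.abs.deltaIntegral₂ h.closed₂ h.least₂).slice₁ hy hz) fun s hs _ _ => i2 s hs
  rw [Jet.dist_eq]
  simp only [PiLp.zero_apply, zero_sub, abs_neg]
  refine add_le_add (add_le_add ?_ ?_) ?_
  · refine le_trans ?_ h₁
    simp only [goursat, PiLp.toLp_apply, Matrix.cons_val_zero]
    refine (abs_add_le _ _).trans (add_le_add ?_ i12)
    exact (abs_sub _ _).trans (add_le_add (abs_add_le _ _) le_rfl)
  · by_cases hk : x ∈ kappa T₁
    · refine le_trans ?_ (h₂ hk)
      simp only [goursat, PiLp.toLp_apply, Matrix.cons_val_one, Matrix.cons_val_zero,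
        indicator_of_mem hk, one_mul]
      exact (abs_add_le _ _).trans (add_le_add le_rfl (i2 x hx))
    · simpa [goursat, hk] using hk₂
  · by_cases hk : y ∈ kappa T₂
    · refine le_trans ?_ (h₃ hk)
      simp only [goursat, PiLp.toLp_apply, Matrix.cons_val, indicator_of_mem hk, one_mul]
      exact (abs_add_le _ _).trans (add_le_add le_rfl i1)
    · simpa [goursat, hk] using hk₃

end Goursat

/-! ### The nonlinear right-hand side -/

/-- The right-hand side of the integro-differential equation, as a function of `(x, y, z)`, for an
arbitrary jet `w` in the place of `(u, u^{Δ₁}, u^{Δ₂})`. -/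
noncomputable def rightSide (I : Set ℝ) (a b : ℝ) (F G : ℝ → ℝ → ℝ → ℝ → ℝ → ℝ → ℝ → ℝ)
    (w : ℝ × ℝ × ℝ → Jet) (p : ℝ × ℝ × ℝ) : ℝ :=
  F p.1 p.2.1 p.2.2 (w p 0) (w p 1) (w p 2)
    (deltaIntegral I (fun q => G p.1 p.2.1 p.2.2 q (w (p.1, p.2.1, q) 0) (w (p.1, p.2.1, q) 1)
      (w (p.1, p.2.1, q) 2)) a b)

section RightSide

variable {T₁ T₂ I : Set ℝ} {a b : ℝ} {F G : ℝ → ℝ → ℝ → ℝ → ℝ → ℝ → ℝ → ℝ}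
  {w w' : ℝ × ℝ × ℝ → Jet}

lemma rightSide_congr (hI : IsClosed I) (ha : IsLeast I a) (hb : b ∈ I)
    (h : EqOn w w' (RdDomain.triple T₁ T₂ I).carrier) :
    EqOn (rightSide I a b F G w) (rightSide I a b F G w') (RdDomain.triple T₁ T₂ I).carrier := by
  rintro ⟨x, y, z⟩ ⟨hx, hy, hz⟩
  unfold rightSide
  rw [h ⟨hx, hy, hz⟩]
  congr 1
  exact deltaIntegral_congr hI ha.1 (ha.2 hb) fun q hq _ _ => by
    simp only [h (x := (x, y, q)) ⟨hx, hy, hq⟩]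

lemma rdCont_integrand
    (hG : RdContinuous (n := 4) (m := 3) ![T₁, T₂, I, I]
      (fun t p => G (t 0) (t 1) (t 2) (t 3) (p 0) (p 1) (p 2)))
    (hw : ∀ i, RdCont (RdDomain.triple T₁ T₂ I) fun p => w p i) :
    RdCont ((RdDomain.triple T₁ T₂ I).prod (RdDomain.ofSet I)) fun v =>
      G v.1.1 v.1.2.1 v.1.2.2 v.2 (w (v.1.1, v.1.2.1, v.2) 0) (w (v.1.1, v.1.2.1, v.2) 1)
        (w (v.1.1, v.1.2.1, v.2) 2) := by
  have hmap : ∀ i, RdMap ((RdDomain.triple T₁ T₂ I).prod (RdDomain.ofSet I))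
      (RdDomain.ofSet ((![T₁, T₂, I, I] : Fin 4 → Set ℝ) i))
      fun v => (![v.1.1, v.1.2.1, v.1.2.2, v.2] : Fin 4 → ℝ) i := by
    intro i
    fin_cases i
    · exact rdMap_id.fst.fst
    · exact rdMap_id.fst.snd.fst
    · exact rdMap_id.fst.snd.snd
    · exact rdMap_id.snd
  have hdiag : RdMap ((RdDomain.triple T₁ T₂ I).prod (RdDomain.ofSet I)) (RdDomain.triple T₁ T₂ I)
      fun v => (v.1.1, v.1.2.1, v.2) :=
    rdMap_id.fst.fst.prodMk (rdMap_id.fst.snd.fst.prodMk rdMap_id.snd)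
  exact RdCont.subst (hG.exists_tendsto hmap)
    (f := fun (v : (ℝ × ℝ × ℝ) × ℝ) (r : Fin 3 → ℝ) =>
      G v.1.1 v.1.2.1 v.1.2.2 v.2 (r 0) (r 1) (r 2))
    (g := fun (v : (ℝ × ℝ × ℝ) × ℝ) (i : Fin 3) => w (v.1.1, v.1.2.1, v.2) i)
    (rdCont_pi fun i => (hw i).comp hdiag)

/-- Integrals over the last variable of a function on `T₁ × T₂ × I × I` are rd-continuous. -/
lemma RdCont.deltaIntegral_last (hI : IsClosed I) (ha : IsLeast I a) (hb : b ∈ I)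
    {g : (ℝ × ℝ × ℝ) × ℝ → ℝ}
    (hg : RdCont ((RdDomain.triple T₁ T₂ I).prod (RdDomain.ofSet I)) g) :
    RdCont (RdDomain.triple T₁ T₂ I)
      fun p => TimeScale.deltaIntegral I (fun q => g (p, q)) a b :=
  (hg.deltaIntegral hI ha).comp (rdMap_id.prodMk (rdMap_const hb))

lemma rdCont_rightSide (hI : IsClosed I) (ha : IsLeast I a) (hb : b ∈ I)
    (hF : RdContinuous (n := 3) (m := 4) ![T₁, T₂, I]
      (fun t p => F (t 0) (t 1) (t 2) (p 0) (p 1) (p 2) (p 3)))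
    (hG : RdContinuous (n := 4) (m := 3) ![T₁, T₂, I, I]
      (fun t p => G (t 0) (t 1) (t 2) (t 3) (p 0) (p 1) (p 2)))
    (hw : ∀ i, RdCont (RdDomain.triple T₁ T₂ I) fun p => w p i) :
    RdCont (RdDomain.triple T₁ T₂ I) (rightSide I a b F G w) := by
  have hmap : ∀ i, RdMap (RdDomain.triple T₁ T₂ I)
      (RdDomain.ofSet ((![T₁, T₂, I] : Fin 3 → Set ℝ) i))
      fun p => (![p.1, p.2.1, p.2.2] : Fin 3 → ℝ) i := by
    intro i
    fin_cases i
    · exact rdMap_id.fst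
    · exact rdMap_id.snd.fst
    · exact rdMap_id.snd.snd
  refine RdCont.subst (hF.exists_tendsto hmap)
    (f := fun (p : ℝ × ℝ × ℝ) (r : Fin 4 → ℝ) => F p.1 p.2.1 p.2.2 (r 0) (r 1) (r 2) (r 3))
    (g := fun p => ![w p 0, w p 1, w p 2,
    deltaIntegral I (fun q => G p.1 p.2.1 p.2.2 q (w (p.1, p.2.1, q) 0) (w (p.1, p.2.1, q) 1)
      (w (p.1, p.2.1, q) 2)) a b]) (rdCont_pi fun i => ?_)
  fin_cases i
  · exact hw 0
  · exact hw 1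
  · exact hw 2
  · exact (rdCont_integrand hG hw).deltaIntegral_last hI ha hb

/-- The Lipschitz conditions, for jets whose distance is at most `k` times a weight `e`. -/
lemma abs_rightSide_sub_le (hI : IsClosed I) (ha : IsLeast I a) (hb : b ∈ I)
    (hG : RdContinuous (n := 4) (m := 3) ![T₁, T₂, I, I]
      (fun t p => G (t 0) (t 1) (t 2) (t 3) (p 0) (p 1) (p 2)))
    (hw : ∀ i, RdCont (RdDomain.triple T₁ T₂ I) fun p => w p i)
    (hw' : ∀ i, RdCont (RdDomain.triple T₁ T₂ I) fun p => w' p i)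
    {M e : ℝ → ℝ → ℝ → ℝ} {K : ℝ → ℝ → ℝ → ℝ → ℝ}
    (hM : ∀ x ∈ T₁, ∀ y ∈ T₂, ∀ z ∈ I, 0 ≤ M x y z)
    (hK : ∀ x ∈ T₁, ∀ y ∈ T₂, ∀ z ∈ I, ∀ q ∈ I, 0 ≤ K x y z q)
    (hKe : RdCont ((RdDomain.triple T₁ T₂ I).prod (RdDomain.ofSet I))
      fun v => K v.1.1 v.1.2.1 v.1.2.2 v.2 * e v.1.1 v.1.2.1 v.2)
    (hF_lip : ∀ x ∈ T₁, ∀ y ∈ T₂, ∀ z ∈ I, ∀ u₁ u₂ u₃ u₄ v₁ v₂ v₃ v₄ : ℝ,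
        |F x y z u₁ u₂ u₃ u₄ - F x y z v₁ v₂ v₃ v₄| ≤
          M x y z * (|u₁ - v₁| + |u₂ - v₂| + |u₃ - v₃| + |u₄ - v₄|))
    (hG_lip : ∀ x ∈ T₁, ∀ y ∈ T₂, ∀ z ∈ I, ∀ q ∈ I, ∀ u₁ u₂ u₃ v₁ v₂ v₃ : ℝ,
        |G x y z q u₁ u₂ u₃ - G x y z q v₁ v₂ v₃| ≤
          K x y z q * (|u₁ - v₁| + |u₂ - v₂| + |u₃ - v₃|))
    {k : ℝ} (hk : ∀ x ∈ T₁, ∀ y ∈ T₂, ∀ z ∈ I, dist (w (x, y, z)) (w' (x, y, z)) ≤ k * e x y z)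
    {x y z : ℝ} (hx : x ∈ T₁) (hy : y ∈ T₂) (hz : z ∈ I) :
    |rightSide I a b F G w (x, y, z) - rightSide I a b F G w' (x, y, z)| ≤
      k * (M x y z * (e x y z + deltaIntegral I (fun q => K x y z q * e x y q) a b)) := by
  have hslice : RdMap (RdDomain.ofSet I) ((RdDomain.triple T₁ T₂ I).prod (RdDomain.ofSet I))
      fun q => ((x, y, z), q) := rdMap_slice ⟨hx, hy, hz⟩
  have hH := abs_deltaIntegral_sub_le hI ha.1 (ha.2 hb) ((rdCont_integrand hG hw).comp hslice)
    ((rdCont_integrand hG hw').comp hslice)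
    (g := fun q => k * (K x y z q * e x y q)) ((rdCont_const k).mul (hKe.comp hslice))
    (fun q hq => by
      refine (hG_lip x hx y hy z hz q hq _ _ _ _ _ _).trans ?_
      rw [← Jet.dist_eq]
      calc _ ≤ K x y z q * (k * e x y q) :=
            mul_le_mul_of_nonneg_left (hk x hx y hy q hq) (hK x hx y hy z hz q hq)
        _ = _ := by ring)
  rw [deltaIntegral_const_mul] at hH
  refine (hF_lip x hx y hy z hz _ _ _ _ _ _ _ _).trans ?_
  have h1 := hk x hx y hy z hz
  rw [Jet.dist_eq] at h1
  calc _ ≤ M x y z * (k * e x y z + k * deltaIntegral I (fun q => K x y z q * e x y q) a b) :=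
        mul_le_mul_of_nonneg_left (add_le_add h1 hH) (hM x hx y hy z hz)
    _ = _ := by ring

end RightSide

lemma RdContinuous₂.rdCont {T T' : Set ℝ} {h : ℝ → ℝ → ℝ} (hh : RdContinuous₂ T T' h) :
    RdCont ((RdDomain.ofSet T).prod (RdDomain.ofSet T')) fun v => h v.1 v.2 :=
  RdContinuous.rdCont (f := fun t => h (t 0) (t 1)) hh
    (φ := fun v : ℝ × ℝ => ![v.1, v.2]) fun i => by
    fin_cases i
    · exact rdMap_id.fst
    · exact rdMap_id.snd

lemma RdContinuous₃.rdCont {T T' T'' : Set ℝ} {h : ℝ → ℝ → ℝ → ℝ}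
    (hh : RdContinuous₃ T T' T'' h) :
    RdCont (RdDomain.triple T T' T'') fun v => h v.1 v.2.1 v.2.2 :=
  RdContinuous.rdCont (f := fun t => h (t 0) (t 1) (t 2)) hh
    (φ := fun v : ℝ × ℝ × ℝ => ![v.1, v.2.1, v.2.2])
    fun i => by
      fin_cases i
      · exact rdMap_id.fst
      · exact rdMap_id.snd.fst
      · exact rdMap_id.snd.snd

end TimeScale

/-! ### Existence and uniqueness -/

theorem theorem1p1
    (T₁ T₂ T₃ : Set ℝ)
    (hT₁ : TimeScale.IsTimeScale T₁) (hT₁' : T₁.Nontrivial)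
    (hT₂ : TimeScale.IsTimeScale T₂) (hT₂' : T₂.Nontrivial)
    (hT₃ : TimeScale.IsTimeScale T₃)
    (x₀ y₀ a b lam : ℝ)
    (hx₀ : IsLeast T₁ x₀) (hy₀ : IsLeast T₂ y₀)
    (ha : a ∈ T₃) (hb : b ∈ T₃) (hab : a < b)
    -- the points that occur in `e_lam(|z|, 0)` lie in the time scale of `z`
    (h0 : (0 : ℝ) ∈ T₃) (habs : ∀ z ∈ T₃ ∩ Set.Icc a b, |z| ∈ T₃)
    (hlam : 0 < lam)
    (F : ℝ → ℝ → ℝ → ℝ → ℝ → ℝ → ℝ → ℝ) (G : ℝ → ℝ → ℝ → ℝ → ℝ → ℝ → ℝ → ℝ)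
    (α β : ℝ → ℝ → ℝ) (M : ℝ → ℝ → ℝ → ℝ) (K : ℝ → ℝ → ℝ → ℝ → ℝ)
    -- rd-continuity of the data
    (hF : TimeScale.RdContinuous (n := 3) (m := 4) ![T₁, T₂, T₃ ∩ Set.Icc a b]
      (fun t p => F (t 0) (t 1) (t 2) (p 0) (p 1) (p 2) (p 3)))
    (hG : TimeScale.RdContinuous (n := 4) (m := 3)
      ![T₁, T₂, T₃ ∩ Set.Icc a b, T₃ ∩ Set.Icc a b]
      (fun t p => G (t 0) (t 1) (t 2) (t 3) (p 0) (p 1) (p 2)))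
    (hα : TimeScale.RdContinuous₂ T₁ (T₃ ∩ Set.Icc a b) α)
    (hβ : TimeScale.RdContinuous₂ T₂ (T₃ ∩ Set.Icc a b) β)
    (hα_diff : ∀ z ∈ T₃ ∩ Set.Icc a b, TimeScale.DeltaDifferentiable T₁ (fun s => α s z))
    (hβ_diff : ∀ z ∈ T₃ ∩ Set.Icc a b, TimeScale.DeltaDifferentiable T₂ (fun t => β t z))
    (hα_rd : TimeScale.RdContinuous₂ T₁ (T₃ ∩ Set.Icc a b)
      (fun x z => TimeScale.deltaDeriv T₁ (fun s => α s z) x))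
    (hβ_rd : TimeScale.RdContinuous₂ T₂ (T₃ ∩ Set.Icc a b)
      (fun y z => TimeScale.deltaDeriv T₂ (fun t => β t z) y))
    (hαβ : ∀ z ∈ T₃ ∩ Set.Icc a b, α x₀ z = β y₀ z)
    -- Lipschitz conditions
    (hM : TimeScale.RdContinuous₃ T₁ T₂ (T₃ ∩ Set.Icc a b) M)
    (hM_nonneg : ∀ x ∈ T₁, ∀ y ∈ T₂, ∀ z ∈ T₃ ∩ Set.Icc a b, 0 ≤ M x y z)
    (hK : TimeScale.RdContinuous (n := 4) (m := 0)
      ![T₁, T₂, T₃ ∩ Set.Icc a b, T₃ ∩ Set.Icc a b]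
      (fun t _ => K (t 0) (t 1) (t 2) (t 3)))
    (hK_nonneg : ∀ x ∈ T₁, ∀ y ∈ T₂, ∀ z ∈ T₃ ∩ Set.Icc a b, ∀ q ∈ T₃ ∩ Set.Icc a b,
      0 ≤ K x y z q)
    (hF_lip : ∀ x ∈ T₁, ∀ y ∈ T₂, ∀ z ∈ T₃ ∩ Set.Icc a b,
      ∀ u₁ u₂ u₃ u₄ v₁ v₂ v₃ v₄ : ℝ,
        |F x y z u₁ u₂ u₃ u₄ - F x y z v₁ v₂ v₃ v₄| ≤
          M x y z * (|u₁ - v₁| + |u₂ - v₂| + |u₃ - v₃| + |u₄ - v₄|))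
    (hG_lip : ∀ x ∈ T₁, ∀ y ∈ T₂, ∀ z ∈ T₃ ∩ Set.Icc a b, ∀ q ∈ T₃ ∩ Set.Icc a b,
      ∀ u₁ u₂ u₃ v₁ v₂ v₃ : ℝ,
        |G x y z q u₁ u₂ u₃ - G x y z q v₁ v₂ v₃| ≤
          K x y z q * (|u₁ - v₁| + |u₂ - v₂| + |u₃ - v₃|))
    -- integral bounds for the Lipschitz coefficients
    (γ₁ γ₂ γ₃ : ℝ) (hγ₁ : 0 ≤ γ₁) (hγ₂ : 0 ≤ γ₂) (hγ₃ : 0 ≤ γ₃)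
    (hb₁ : ∀ x ∈ T₁, ∀ y ∈ T₂, ∀ z ∈ T₃ ∩ Set.Icc a b,
      TimeScale.deltaIntegral T₁ (fun s => TimeScale.deltaIntegral T₂ (fun t =>
        M s t z * (TimeScale.expWeight T₁ T₂ T₃ x₀ y₀ lam s t z +
          TimeScale.deltaIntegral T₃ (fun q =>
            K s t z q * TimeScale.expWeight T₁ T₂ T₃ x₀ y₀ lam s t q) a b)) y₀ y) x₀ x
        ≤ γ₁ * TimeScale.expWeight T₁ T₂ T₃ x₀ y₀ lam x y z)
    (hb₂ : ∀ x ∈ T₁, ∀ y ∈ T₂, ∀ z ∈ T₃ ∩ Set.Icc a b,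
      TimeScale.deltaIntegral T₂ (fun t =>
        M x t z * (TimeScale.expWeight T₁ T₂ T₃ x₀ y₀ lam x t z +
          TimeScale.deltaIntegral T₃ (fun q =>
            K x t z q * TimeScale.expWeight T₁ T₂ T₃ x₀ y₀ lam x t q) a b)) y₀ y
        ≤ γ₂ * TimeScale.expWeight T₁ T₂ T₃ x₀ y₀ lam x y z)
    (hb₃ : ∀ x ∈ T₁, ∀ y ∈ T₂, ∀ z ∈ T₃ ∩ Set.Icc a b,
      TimeScale.deltaIntegral T₁ (fun s =>
        M s y z * (TimeScale.expWeight T₁ T₂ T₃ x₀ y₀ lam s y z +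
          TimeScale.deltaIntegral T₃ (fun q =>
            K s y z q * TimeScale.expWeight T₁ T₂ T₃ x₀ y₀ lam s y q) a b)) x₀ x
        ≤ γ₃ * TimeScale.expWeight T₁ T₂ T₃ x₀ y₀ lam x y z)
    -- growth bounds for the data; `opH … (fun _ _ _ => 0)` is `H0`
    (η₁ η₂ η₃ : ℝ) (hη₁ : 0 ≤ η₁) (hη₂ : 0 ≤ η₂) (hη₃ : 0 ≤ η₃)
    (hd₁ : ∀ x ∈ T₁, ∀ y ∈ T₂, ∀ z ∈ T₃ ∩ Set.Icc a b,
      |α x z| + |β y z| + |α x₀ z| +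
        TimeScale.deltaIntegral T₁ (fun s => TimeScale.deltaIntegral T₂ (fun t =>
          |F s t z 0 0 0 (TimeScale.opH T₁ T₂ T₃ a b G (fun _ _ _ => 0) s t z)|) y₀ y) x₀ x
        ≤ η₁ * TimeScale.expWeight T₁ T₂ T₃ x₀ y₀ lam x y z)
    (hd₂ : ∀ x ∈ TimeScale.kappa T₁, ∀ y ∈ T₂, ∀ z ∈ T₃ ∩ Set.Icc a b,
      |TimeScale.deltaDeriv T₁ (fun s => α s z) x| +
        TimeScale.deltaIntegral T₂ (fun t =>
          |F x t z 0 0 0 (TimeScale.opH T₁ T₂ T₃ a b G (fun _ _ _ => 0) x t z)|) y₀ y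
        ≤ η₂ * TimeScale.expWeight T₁ T₂ T₃ x₀ y₀ lam x y z)
    (hd₃ : ∀ x ∈ T₁, ∀ y ∈ TimeScale.kappa T₂, ∀ z ∈ T₃ ∩ Set.Icc a b,
      |TimeScale.deltaDeriv T₂ (fun t => β t z) y| +
        TimeScale.deltaIntegral T₁ (fun s =>
          |F s y z 0 0 0 (TimeScale.opH T₁ T₂ T₃ a b G (fun _ _ _ => 0) s y z)|) x₀ x
        ≤ η₃ * TimeScale.expWeight T₁ T₂ T₃ x₀ y₀ lam x y z)
    (hγ : γ₁ + γ₂ + γ₃ < 1) :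
    ∃ u : ℝ → ℝ → ℝ → ℝ,
      TimeScale.MemS T₁ T₂ T₃ a b x₀ y₀ lam u ∧
      TimeScale.IsSolution T₁ T₂ T₃ a b x₀ y₀ F G α β u ∧
      ∀ v : ℝ → ℝ → ℝ → ℝ,
        TimeScale.MemS T₁ T₂ T₃ a b x₀ y₀ lam v →
        TimeScale.IsSolution T₁ T₂ T₃ a b x₀ y₀ F G α β v →
        ∀ x ∈ T₁, ∀ y ∈ T₂, ∀ z ∈ T₃ ∩ Set.Icc a b, v x y z = u x y z := by
  set I := T₃ ∩ Set.Icc a b with hI_def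
  have hI : IsClosed I := hT₃.2.inter isClosed_Icc
  have haI : IsLeast I a := ⟨⟨ha, le_rfl, hab.le⟩, fun q hq => hq.2.1⟩
  have hbI : b ∈ I := ⟨hb, hab.le, le_rfl⟩
  have hint : ∀ f, TimeScale.deltaIntegral T₃ f a b = TimeScale.deltaIntegral I f a b :=
    TimeScale.deltaIntegral_inter_Icc hT₃.2 ha hab.le
  simp only [TimeScale.opH, hint] at hb₁ hb₂ hb₃ hd₁ hd₂ hd₃
  have hdata : TimeScale.GoursatData T₁ T₂ I x₀ y₀ α β :=
    ⟨hT₁.2, hT₂.2, hT₁', hT₂', hx₀, hy₀, hα.rdCont, hβ.rdCont, hα_rd.rdCont, hβ_rd.rdCont,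
      hα_diff, hβ_diff, hαβ⟩
  set D := TimeScale.RdDomain.triple T₁ T₂ I with hD
  set e : ℝ → ℝ → ℝ → ℝ := TimeScale.expWeight T₁ T₂ T₃ x₀ y₀ lam with he_def
  have he : TimeScale.RdCont D fun p => e p.1 p.2.1 p.2.2 :=
    TimeScale.rdCont_expWeight hT₁.2 hT₂.2 hT₃.2 hx₀ hy₀ h0 hlam.le
  have hepos : ∀ x y z, 0 < e x y z := TimeScale.expWeight_pos T₁ T₂ T₃ x₀ y₀ lam
  have hKe : TimeScale.RdCont (D.prod (TimeScale.RdDomain.ofSet I))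
      fun v => K v.1.1 v.1.2.1 v.1.2.2 v.2 * e v.1.1 v.1.2.1 v.2 := by
    refine TimeScale.RdCont.mul (TimeScale.RdContinuous.rdCont
      (f := fun t => K (t 0) (t 1) (t 2) (t 3)) hK
      (φ := fun v : (ℝ × ℝ × ℝ) × ℝ => ![v.1.1, v.1.2.1, v.1.2.2, v.2]) fun i => ?_)
      (he.comp (φ := fun v : (ℝ × ℝ × ℝ) × ℝ => (v.1.1, v.1.2.1, v.2))
        (TimeScale.rdMap_id.fst.fst.prodMk
          (TimeScale.rdMap_id.fst.snd.fst.prodMk TimeScale.rdMap_id.snd)))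
    fin_cases i
    · exact TimeScale.rdMap_id.fst.fst
    · exact TimeScale.rdMap_id.fst.snd.fst
    · exact TimeScale.rdMap_id.fst.snd.snd
    · exact TimeScale.rdMap_id.snd
  -- the coefficient `E` of the integral bounds
  set E : ℝ × ℝ × ℝ → ℝ := fun p => M p.1 p.2.1 p.2.2 * (e p.1 p.2.1 p.2.2 +
    TimeScale.deltaIntegral I (fun q => K p.1 p.2.1 p.2.2 q * e p.1 p.2.1 q) a b) with hE_def
  have hE : TimeScale.RdCont D E := hM.rdCont.mul (he.add (hKe.deltaIntegral_last hI haI hbI))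
  -- the solutions are the fixed points of `A` among the functions with the property `P`
  set R : (ℝ × ℝ × ℝ → TimeScale.Jet) → ℝ × ℝ × ℝ → ℝ :=
    TimeScale.rightSide I a b F G with hR_def
  set A : (ℝ × ℝ × ℝ → TimeScale.Jet) → ℝ × ℝ × ℝ → TimeScale.Jet :=
    fun w => TimeScale.goursat T₁ T₂ x₀ y₀ α β (R w) with hA_def
  set P : (ℝ × ℝ × ℝ → TimeScale.Jet) → Prop :=
    fun w => ∀ i, TimeScale.RdCont D fun p => w p i with hP_def
  have hR : ∀ w, P w → TimeScale.RdCont D (R w) := fun w hw =>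
    TimeScale.rdCont_rightSide hI haI hbI hF hG hw
  have hAP : ∀ w, P w → P (A w) := fun w hw i => hdata.rdCont_goursat (hR w hw) i
  have hlip : ∀ w w', P w → P w' → ∀ k,
      (∀ p ∈ D.carrier, dist (w p) (w' p) ≤ k * e p.1 p.2.1 p.2.2) →
      ∀ p ∈ D.carrier, dist (A w p) (A w' p) ≤ (γ₁ + γ₂ + γ₃) * k * e p.1 p.2.1 p.2.2 := by
    rintro w w' hw hw' k hk ⟨x, y, z⟩ ⟨hx, hy, hz⟩
    have hk0 : 0 ≤ k := nonneg_of_mul_nonneg_left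
      (dist_nonneg.trans (hk (x, y, z) ⟨hx, hy, hz⟩)) (hepos _ _ _)
    have h := hdata.dist_goursat_le (hR w hw) (hR w' hw') (g := fun p => k * E p)
      ((TimeScale.rdCont_const k).mul hE)
      (by
        rintro ⟨s, t, r⟩ ⟨hs, ht, hr⟩
        exact TimeScale.abs_rightSide_sub_le hI haI hbI hG hw hw' hM_nonneg hK_nonneg hKe hF_lip
          hG_lip (fun x hx y hy z hz => hk (x, y, z) ⟨hx, hy, hz⟩) hs ht hr) hx hy hz
    simp only [TimeScale.deltaIntegral_const_mul] at h
    refine h.trans ?_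
    have h1 := mul_le_mul_of_nonneg_left (hb₁ x hx y hy z hz) hk0
    have h2 := mul_le_mul_of_nonneg_left (hb₂ x hx y hy z hz) hk0
    have h3 := mul_le_mul_of_nonneg_left (hb₃ x hx y hy z hz) hk0
    refine (add_le_add (add_le_add h1 h2) h3).trans (le_of_eq ?_)
    ring
  have hγ0 : 0 ≤ γ₁ + γ₂ + γ₃ := add_nonneg (add_nonneg hγ₁ hγ₂) hγ₃
  have hPlim : ∀ (w : ℕ → ℝ × ℝ × ℝ → TimeScale.Jet) (w' : ℝ × ℝ × ℝ → TimeScale.Jet) (r : ℕ → ℝ),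
      (∀ n, P (w n)) → Tendsto r atTop (𝓝 0) →
      (∀ n, ∀ p ∈ D.carrier, dist (w n p) (w' p) ≤ r n * e p.1 p.2.1 p.2.2) → P w' := by
    intro w w' r hw hr hd i
    refine TimeScale.RdCont.of_weighted_limit (fun n => hw n i) he hr fun n p hp => ?_
    refine le_trans ?_ (hd n p hp)
    rw [dist_eq_norm]
    exact PiLp.norm_apply_le (w n p - w' p) i
  have hP0 : P 0 := fun i => TimeScale.rdCont_const 0
  have hA0 : ∀ p ∈ D.carrier, dist ((0 : ℝ × ℝ × ℝ → TimeScale.Jet) p) (A 0 p) ≤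
      (η₁ + η₂ + η₃) * e p.1 p.2.1 p.2.2 := by
    rintro ⟨x, y, z⟩ ⟨hx, hy, hz⟩
    have hpos := (hepos x y z).le
    -- `H` is applied to the zero function, whose derivatives vanish
    have h0₁ : ∀ x y z, TimeScale.pderiv₁ T₁ (fun _ _ _ => 0) x y z = 0 := fun x _ _ =>
      TimeScale.deltaDeriv_zero hT₁' x
    have h0₂ : ∀ x y z, TimeScale.pderiv₂ T₂ (fun _ _ _ => 0) x y z = 0 := fun _ y _ =>
      TimeScale.deltaDeriv_zero hT₂' y
    simp only [h0₁, h0₂] at hd₁ hd₂ hd₃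
    have h := hdata.dist_zero_goursat_le (hR 0 hP0) hx hy hz (hd₁ x hx y hy z hz)
      (mul_nonneg hη₂ hpos) (mul_nonneg hη₃ hpos) (fun hk => hd₂ x hk y hy z hz)
      (fun hk => hd₃ x hx y hk z hz)
    exact h.trans (le_of_eq (by ring))
  obtain ⟨w, hwP, hwfix, hwgrowth⟩ := TimeScale.exists_fixedPoint_of_weight
    (e := fun p => e p.1 p.2.1 p.2.2) hγ0 hγ hAP hlip hPlim hP0 hA0
  have hjet_eq : ∀ (u : ℝ → ℝ → ℝ → ℝ) x y z, TimeScale.absW T₁ T₂ u x y z =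
      dist 0 (TimeScale.jet T₁ T₂ u (x, y, z)) := fun u x y z => by
    simp [TimeScale.Jet.dist_eq, TimeScale.absW, TimeScale.jet]
  have hrhs : ∀ (u : ℝ → ℝ → ℝ → ℝ) x y z,
      F x y z (u x y z) (TimeScale.pderiv₁ T₁ u x y z) (TimeScale.pderiv₂ T₂ u x y z)
        (TimeScale.opH T₁ T₂ T₃ a b G u x y z) = R (TimeScale.jet T₁ T₂ u) (x, y, z) :=
    fun u x y z => by rw [TimeScale.opH, hint]; rfl
  have hRw := hR w hwP
  obtain ⟨u, hu_def⟩ : ∃ u : ℝ → ℝ → ℝ → ℝ, ∀ x y z, u x y z = A w (x, y, z) 0 :=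
    ⟨_, fun _ _ _ => rfl⟩
  have hu : EqOn (TimeScale.jet T₁ T₂ u) (A w) D.carrier :=
    hdata.jet_eq_goursat hRw fun x _ y _ z _ => hu_def x y z
  have huw : EqOn (TimeScale.jet T₁ T₂ u) w D.carrier := fun p hp => (hu hp).trans (hwfix p hp)
  have hrd : ∀ i, TimeScale.RdCont D fun p => TimeScale.jet T₁ T₂ u p i := fun i =>
    (hwP i).congr fun p hp => by rw [huw hp]
  refine ⟨u,
    ⟨fun y hy z hz x hx => ⟨_, (hdata.hasDeltaDerivAt_goursat₁ hRw hx hy hz).congr hT₁.2 hx.1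
      fun s _ => hu_def s y z⟩,
    fun x hx z hz y hy => ⟨_, (hdata.hasDeltaDerivAt_goursat₂ hRw hx hy hz).congr hT₂.2 hy.1
      fun t _ => hu_def x t z⟩,
    TimeScale.RdCont.rdContinuous₃ (hrd 0), TimeScale.RdCont.rdContinuous₃ (hrd 1),
    TimeScale.RdCont.rdContinuous₃ (hrd 2), ?_⟩,
    ⟨?_, ?_, ?_⟩, ?_⟩
  · refine ⟨(η₁ + η₂ + η₃) / (1 - (γ₁ + γ₂ + γ₃)),
      div_nonneg (add_nonneg (add_nonneg hη₁ hη₂) hη₃) (sub_pos.2 hγ).le, fun x hx y hy z hz => ?_⟩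
    rw [hjet_eq, huw (x := (x, y, z)) ⟨hx, hy, hz⟩]
    exact hwgrowth (x, y, z) ⟨hx, hy, hz⟩
  · intro x hx y hy z hz
    have hRu : R (TimeScale.jet T₁ T₂ u) (x, y, z) = R w (x, y, z) :=
      TimeScale.rightSide_congr hI haI hbI huw ⟨hx.1, hy.1, hz⟩
    rw [hrhs, hRu]
    refine (hdata.hasDeltaDerivAt_goursat₂₁ hRw hx.1 hy hz).congr hT₁.2 hx.1 fun s hs => ?_
    exact congrArg (fun j : TimeScale.Jet => j 2) (hu (x := (s, y, z)) ⟨hs, hy.1, hz⟩)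
  · intro x hx z hz
    simp [hu_def, hA_def, TimeScale.goursat, hαβ z hz, TimeScale.deltaIntegral]
  · intro y hy z hz
    simp [hu_def, hA_def, TimeScale.goursat, TimeScale.deltaIntegral_self]
  · intro v hv hsol x hx y hy z hz
    have hvP : P (TimeScale.jet T₁ T₂ v) := fun i => by
      fin_cases i
      · exact hv.rd.rdCont
      · exact hv.rd₁.rdCont
      · exact hv.rd₂.rdCont
    have hvA : EqOn (TimeScale.jet T₁ T₂ v) (A (TimeScale.jet T₁ T₂ v)) D.carrier := by
      refine hdata.jet_eq_goursat (hR _ hvP) (hdata.eq_goursat (hR _ hvP) hv.diff₂ hv.rd₂.rdCont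
        (fun x hx y hy z hz => ?_) hsol.bdry₁ hsol.bdry₂)
      rw [← hrhs]
      exact hsol.eqn x hx y hy z hz
    obtain ⟨N, -, hN⟩ := hv.growth
    have hdist : ∀ p ∈ D.carrier, dist (TimeScale.jet T₁ T₂ v p) (w p) ≤
        (N + (η₁ + η₂ + η₃) / (1 - (γ₁ + γ₂ + γ₃))) * e p.1 p.2.1 p.2.2 := by
      rintro p hp
      have h1 := hN p.1 hp.1 p.2.1 hp.2.1 p.2.2 hp.2.2
      rw [hjet_eq] at h1
      have h2 := hwgrowth p hp
      rw [add_mul]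
      refine (dist_triangle_left _ _ (0 : TimeScale.Jet)).trans (add_le_add h1 h2)
    have hvw := TimeScale.eqOn_of_fixedPoint_of_weight (e := fun p => e p.1 p.2.1 p.2.2) hγ0 hγ hlip
      hvP hwP (fun p hp => (hvA hp).symm) hwfix hdist
    have hfin := (hvw (x := (x, y, z)) ⟨hx, hy, hz⟩).trans
      (huw (x := (x, y, z)) ⟨hx, hy, hz⟩).symm
    exact congrArg (fun j : TimeScale.Jet => j 0) hfin
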